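/- Let $\omega=(-1+\sqrt{-31})/2$, so that $\mathbf Z[\omega]$ is the quadratic order of discriminant $-31$, let $\mathrm{Norm}$ denote the norm from $\mathbf Z[\omega]$ to $\mathbf Z$, and put \[ \nu = 2(\omega-1)\cdot 5^{322}\cdot(4\omega+1)^{456}(\omega+1)^{670},\qquad p=\mathrm{Norm}(1-\nu). \] Then $p$ is a prime number with exactly $2014$ decimal digits, and the equation $u^3+u+1=0$ has exactly three solutions $u$ in $\mathbf F_p$. For each of these three $u$, the equation \[ y^2=(u-1)(x^2+8)(x^4+16x^2+u^{24}) \] defines a curve of genus $2$ over $\mathbf F_p$, meaning that its completion $C$, the curve $Y^2=(u-1)(X^2+8Z^2)(X^4+16X^2Z^2+u^{24}Z^4)$ in the weighted projective plane over $\mathbf F_p$ with coordinates $X,Y,Z$ of weights $1,3,1$, is a smooth, geometrically connected curve of genus $2$; and $C$ has exactly $10^{2013}$ rational points over $\mathbf F_p$. -/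

import Mathlib

open Polynomial

noncomputable section

/-- The quadratic order `ℤ[ω]` of discriminant `-31`, where `ω² = -8 - ω`,
that is `ω = (-1 + √-31) / 2`. -/
abbrev OrderNeg31 : Type := QuadraticAlgebra ℤ (-8) (-1)

/-- The element `ω` of `ℤ[ω]`. -/
def omega31 : OrderNeg31 := QuadraticAlgebra.omega

/-- In `ℂ` the number `(-1 + √31 i) / 2` satisfies the defining equation of `ω`. -/
theorem omega31_complex :
    ((-1 + (Real.sqrt 31 : ℂ) * Complex.I) / 2) * ((-1 + (Real.sqrt 31 : ℂ) * Complex.I) / 2)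
      = -8 - (-1 + (Real.sqrt 31 : ℂ) * Complex.I) / 2 := by
  have h : (Real.sqrt 31 : ℂ) * (Real.sqrt 31 : ℂ) = 31 := by
    rw [← Complex.ofReal_mul, Real.mul_self_sqrt (by norm_num)]
    norm_num
  linear_combination (1 / 4 : ℂ) * h * Complex.I ^ 2 + (31 / 4 : ℂ) * Complex.I_sq

/-- The element `ν = 2 (ω - 1) 5³²² (4ω + 1)⁴⁵⁶ (ω + 1)⁶⁷⁰` of `ℤ[ω]`. -/
def nu31 : OrderNeg31 :=
  2 * (omega31 - 1) * 5 ^ 322 * (4 * omega31 + 1) ^ 456 * (omega31 + 1) ^ 670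

namespace SexticCurve

variable {k : Type*} [Field k]

/-!
For a polynomial `f` of degree at most `6` over a field `k`, the complete curve with affine
equation `y² = f(x)` is the curve `Y² = F(X, Z)` in the weighted projective plane with
coordinates `X, Y, Z` of weights `1, 3, 1`, where `F(X, Z) = Z⁶ f(X / Z)`.
-/

/-- The weighted homogeneous equation `Y² - F(X, Z)` of the curve; the variables numbered
`0, 1, 2` are `X, Y, Z`. -/
def equation (f : k[X]) : MvPolynomial (Fin 3) k :=
  MvPolynomial.X 1 ^ 2 - MvPolynomial.rename ![0, 2] (f.homogenize 6)

/-- The nonzero solutions over `k` of the weighted homogeneous equation. -/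
def Solution (f : k[X]) : Type _ :=
  {P : Fin 3 → k // P ≠ 0 ∧ MvPolynomial.eval P (equation f) = 0}

/-- Two solutions represent the same point of the weighted projective plane if they differ by
`(X, Y, Z) ↦ (c X, c³ Y, c Z)` for some `c` in `kˣ`. -/
def solutionSetoid (f : k[X]) : Setoid (Solution f) where
  r P Q := ∃ c : kˣ, Q.1 = ![c * P.1 0, c ^ 3 * P.1 1, c * P.1 2]
  iseqv :=
    { refl := fun P => ⟨1, by ext i; fin_cases i <;> simp⟩
      symm := by
        rintro P Q ⟨c, h⟩
        refine ⟨c⁻¹, ?_⟩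
        rw [h]
        ext i
        fin_cases i <;> simp
      trans := by
        rintro P Q R ⟨c, h⟩ ⟨d, h'⟩
        refine ⟨d * c, ?_⟩
        rw [h', h]
        ext i
        fin_cases i <;> simp <;> ring }

/-- The `k`-rational points of the complete curve `y² = f(x)` over `k`. -/
def Point (f : k[X]) : Type _ := Quotient (solutionSetoid f)

/-- Smoothness over `k`, by the Jacobian criterion at all geometric points. No point of the
curve has `X = Z = 0`, so the group of scalars acts freely on the cone of nonzero solutions, and
the curve is smooth if and only if this cone is. -/
def IsSmooth (f : k[X]) : Prop :=
  ∀ P : Fin 3 → AlgebraicClosure k, P ≠ 0 → MvPolynomial.aeval P (equation f) = 0 →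
    ∃ i, MvPolynomial.aeval P (MvPolynomial.pderiv i (equation f)) ≠ 0

/-- The coordinate ring `k[x, x⁻¹, y] / (y² - f(x))` of the part of the curve where
`X` and `Z` are nonzero, with `x = X / Z` and `y = Y / Z³`. -/
abbrev OverlapRing (f : k[X]) : Type _ :=
  AdjoinRoot (X ^ 2 - C (toLaurent f) : (LaurentPolynomial k)[X])

/-- The function `x ^ n` on the overlap. -/
def xPow (f : k[X]) (n : ℤ) : OverlapRing f := AdjoinRoot.of _ (LaurentPolynomial.T n)

/-- The function `y` on the overlap. -/
def yFun (f : k[X]) : OverlapRing f := AdjoinRoot.root _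

/-- The functions on the chart `Z ≠ 0`, which are generated by `x = X / Z` and `y = Y / Z³`. -/
def chartZ (f : k[X]) : Submodule k (OverlapRing f) :=
  Subalgebra.toSubmodule (Algebra.adjoin k {xPow f 1, yFun f})

/-- The functions on the chart `X ≠ 0`, which are generated by `Z / X = x⁻¹` and
`Y / X³ = x⁻³ y`. -/
def chartX (f : k[X]) : Submodule k (OverlapRing f) :=
  Subalgebra.toSubmodule (Algebra.adjoin k {xPow f (-1), xPow f (-3) * yFun f})

/-- The dimension of `H⁰` of the structure sheaf: the global functions are those on the overlap
that extend to both charts. -/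
def h0 (f : k[X]) : ℕ := Module.finrank k ↥(chartZ f ⊓ chartX f)

/-- The dimension of `H¹` of the structure sheaf, computed from the Čech complex of the cover by
the two affine charts. For a smooth, complete, geometrically connected curve it is the genus. -/
def h1 (f : k[X]) : ℕ := Module.finrank k (OverlapRing f ⧸ (chartZ f ⊔ chartX f))

/-- The complete curve `y² = f(x)` is a smooth, geometrically connected curve of genus `2`. -/
def IsGenusTwo (f : k[X]) : Prop :=
  f.natDegree ≤ 6 ∧ IsSmooth f ∧ h0 f = 1 ∧ h1 f = 2

end SexticCurve

end

/-! Put d = u - 1, c = u²⁴ and N = 10²⁰¹³. The sextic d(x² + 8)(x⁴ + 16x² + c) is even, so with t =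
x² and g(t) = d(t + 8)(t² + 16t + c) the curve C covers y² = g(t) and y² = t g(t). The reflection t
↦ -16 - t changes the sign of g, and -1 is a nonsquare because p ≡ 3 mod 4; hence the first quotient
contributes nothing to the point count. The second becomes E : y² = x(x² + ax + b) with a = d(128 -
2c), b = d²c(c - 64), and C and E have equally many rational points (`sum_quadraticChar_sextic`,
`SexticCurve.card_point_sextic`).

The norm of ν is N, so N is the number of points of an elliptic curve with Frobenius 1 - ν. Complex
multiplication explains this choice of p, but the proof does not use it: it rests on explicit points
of E, checked by integer arithmetic modulo p. A point P of order 2²⁰¹³·5¹⁶⁹¹ and a point Q of order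
5³²² generate subgroups with trivial intersection, so N divides the order of E
(`card_dvd_of_independent`). At most two points lie over each x, so this order is at most 2p + 1 <
3N, and it is N or 2N. If it were 2N, the twist of E by -1 would have 2p + 2 - 2N points, but a
certified point of the twist is not killed by that number (`IsCertified.card_eq`).

The same certificate proves that p is prime. Every nonvanishing it needs is tested as coprimality to
p, so it stays valid over 𝔽_q for each prime q dividing p and gives N ≤ 2q + 1. As 4p < (N - 1)²,
every such q exceeds √p (`prime_largePrime`).

Smoothness follows from x⁴ + 16x² + c = (x² + 8)² + (c - 64). The values h⁰ = 1 and h¹ = 2 are read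
off from the monomials on the two charts. -/

/-! ### Arithmetic of x-coordinates on y² = x³ + ax² + bx -/

section TwoTorsionCurve

variable {F : Type*} [Field F]

/-- The Weierstrass curve `y² = x³ + a x² + b x`. -/
def twoTorsionCurve (a b : F) : WeierstrassCurve.Affine F := ⟨0, a, 0, b, 0⟩

theorem twoTorsionCurve_equation {a b x y : F} :
    (twoTorsionCurve a b).Equation x y ↔ y ^ 2 = x * (x ^ 2 + a * x + b) := by
  rw [WeierstrassCurve.Affine.equation_iff]
  simp only [twoTorsionCurve]
  constructor <;> intro h <;> linear_combination h

theorem twoTorsionCurve_nonsingular {a b : F} (h2 : (2 : F) ≠ 0) (hb : b ≠ 0)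
    (hab : a ^ 2 - 4 * b ≠ 0) {x y : F} :
    (twoTorsionCurve a b).Nonsingular x y ↔ y ^ 2 = x * (x ^ 2 + a * x + b) := by
  rw [← twoTorsionCurve_equation]
  refine WeierstrassCurve.Affine.equation_iff_nonsingular_of_Δ_ne_zero ?_ |>.symm
  have : (twoTorsionCurve a b).Δ = 2 ^ 4 * (b ^ 2 * (a ^ 2 - 4 * b)) := by
    simp only [WeierstrassCurve.Δ, WeierstrassCurve.b₂, WeierstrassCurve.b₄, WeierstrassCurve.b₆,
      WeierstrassCurve.b₈, twoTorsionCurve]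
    ring
  rw [this]
  exact mul_ne_zero (pow_ne_zero _ h2) (mul_ne_zero (pow_ne_zero _ hb) hab)

open WeierstrassCurve.Affine

/-- The pair `(X, Z)` consists of homogeneous coordinates for the `x`-coordinate of `P`. -/
def RepX {W : WeierstrassCurve.Affine F} (P : W.Point) (X Z : F) : Prop :=
  ∃ c, c ≠ 0 ∧ X = c * P.xRep 0 ∧ Z = c * P.xRep 1

theorem RepX.zero_iff {W : WeierstrassCurve.Affine F} {P : W.Point} {X Z : F} (h : RepX P X Z) :
    P = 0 ↔ Z = 0 := by
  obtain ⟨c, hc, -, rfl⟩ := h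
  rcases P with _ | ⟨x, y, hP⟩
  · simp [← Point.zero_def]
  · simp [hc]

theorem RepX.some_iff {W : WeierstrassCurve.Affine F} {x y : F} {hP : W.Nonsingular x y}
    {X Z : F} : RepX (Point.some x y hP) X Z ↔ Z ≠ 0 ∧ X = x * Z := by
  constructor
  · rintro ⟨c, hc, h1, h2⟩
    simp at h1 h2
    exact ⟨by rwa [h2], by rw [h1, h2, mul_comm]⟩
  · rintro ⟨h1, h2⟩
    exact ⟨Z, h1, by simp [h2, mul_comm], by simp⟩

theorem RepX.zero_left_iff {W : WeierstrassCurve.Affine F} {X Z : F} :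
    RepX (0 : W.Point) X Z ↔ X ≠ 0 ∧ Z = 0 := by
  constructor
  · rintro ⟨c, hc, h1, h2⟩
    simp at h1 h2
    exact ⟨by rwa [h1], h2⟩
  · rintro ⟨h1, h2⟩
    exact ⟨X, h1, by simp, by simp [h2]⟩

theorem RepX.neg {W : WeierstrassCurve.Affine F} {P : W.Point} {X Z : F} (h : RepX P X Z) :
    RepX (-P) X Z := by
  simpa [RepX] using h

theorem RepX.mul_eq_mul {W : WeierstrassCurve.Affine F} {P : W.Point} {X Z X' Z' : F}
    (h : RepX P X Z) (h' : RepX P X' Z') : X * Z' = X' * Z := by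
  obtain ⟨c, hc, rfl, rfl⟩ := h
  obtain ⟨d, hd, rfl, rfl⟩ := h'
  ring

variable {a b : F}

theorem twoTorsionCurve_negY (x y : F) : (twoTorsionCurve a b).negY x y = -y := by
  simp [negY, twoTorsionCurve]

variable [DecidableEq F]

/-- This is the homogeneous form of x(2P) = (x² - b)² / (4y²), with y² replaced by the cubic. The
two coordinates never vanish together, so the formula also covers the point at infinity and the
2-torsion. -/
theorem RepX.dbl (h2 : (2 : F) ≠ 0) (hb : b ≠ 0) (hab : a ^ 2 - 4 * b ≠ 0)
    {P : (twoTorsionCurve a b).Point} {X Z : F} (h : RepX P X Z) :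
    RepX (P + P) ((X ^ 2 - b * Z ^ 2) ^ 2) (4 * (X * Z) * (X ^ 2 + a * (X * Z) + b * Z ^ 2)) := by
  rcases P with _ | ⟨x, y, hP⟩
  · rw [← Point.zero_def, RepX.zero_left_iff] at h
    rw [← Point.zero_def, add_zero, RepX.zero_left_iff]
    obtain ⟨h1, rfl⟩ := h
    simp [h1]
  · have hy := (twoTorsionCurve_nonsingular h2 hb hab).1 hP
    obtain ⟨hZ, rfl⟩ := RepX.some_iff.1 h
    by_cases hy0 : y = 0
    · have hneg : y = (twoTorsionCurve a b).negY x y := by rw [twoTorsionCurve_negY]; simp [hy0]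
      rw [Point.add_self_of_Y_eq hneg, RepX.zero_left_iff]
      subst hy0
      constructor
      -- If x² = b at a 2-torsion point, the cubic forces a = -2x, hence a² = 4b, which the
      -- discriminant excludes.
      · intro h0
        have h1 : x ^ 2 = b := by
          have : Z ^ 2 * (x ^ 2 - b) = 0 := by
            have := pow_eq_zero_iff (two_ne_zero) |>.1 h0
            linear_combination this
          have := (mul_eq_zero.1 this).resolve_left (pow_ne_zero _ hZ)
          linear_combination this
        have hx : x ≠ 0 := by
          rintro rfl
          apply hb
          rw [← h1]; simp
        have h3 : a = -2 * x := by
          apply mul_left_cancel₀ (pow_ne_zero 2 hx)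
          linear_combination -hy + x * h1
        apply hab
        rw [h3, ← h1]
        ring
      · linear_combination -4 * Z ^ 4 * hy
    · have hne : y ≠ (twoTorsionCurve a b).negY x y := by
        rw [twoTorsionCurve_negY]
        intro h0
        have : 2 * y = 0 := by linear_combination h0
        exact hy0 ((mul_eq_zero.1 this).resolve_left h2)
      rw [Point.add_self_of_Y_ne hne, RepX.some_iff]
      have e : 4 * (x * Z * Z) * ((x * Z) ^ 2 + a * (x * Z * Z) + b * Z ^ 2)
          = (2 * y) ^ 2 * Z ^ 4 := by
        linear_combination -4 * Z ^ 4 * hy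
      rw [e]
      refine ⟨mul_ne_zero (pow_ne_zero _ (mul_ne_zero h2 hy0)) (pow_ne_zero _ hZ), ?_⟩
      have hyy : 2 * y ≠ 0 := mul_ne_zero h2 hy0
      have hl : (twoTorsionCurve a b).slope x x y y * (2 * y) = 3 * x ^ 2 + 2 * a * x + b := by
        rw [slope_of_Y_ne rfl hne, twoTorsionCurve_negY, sub_neg_eq_add, ← two_mul,
          div_mul_cancel₀ _ hyy]
        simp [twoTorsionCurve]
      generalize (twoTorsionCurve a b).slope x x y y = l at hl ⊢
      simp only [addX, twoTorsionCurve]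
      linear_combination -(l * (2 * y) + (3 * x ^ 2 + 2 * a * x + b)) * Z ^ 4 * hl
        + 4 * Z ^ 4 * (a + 2 * x) * hy

/-- Montgomery's differential addition: x(P + Q) x(P - Q) = (x₁x₂ - b)² / (x₁ - x₂)². Dividing by
x(Q - P) requires that Q - P be neither infinity nor the point with x = 0. -/
theorem RepX.diffAdd (h2 : (2 : F) ≠ 0) (hb : b ≠ 0) (hab : a ^ 2 - 4 * b ≠ 0)
    {P Q : (twoTorsionCurve a b).Point} {X₁ Z₁ X₂ Z₂ X Z : F} (hP : RepX P X₁ Z₁)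
    (hQ : RepX Q X₂ Z₂) (hPQ : RepX (Q - P) X Z) (hX : X ≠ 0) (hZ : Z ≠ 0) :
    RepX (P + Q) (Z * (X₁ * X₂ - b * (Z₁ * Z₂)) ^ 2) (X * (X₁ * Z₂ - X₂ * Z₁) ^ 2) := by
  rcases P with _ | ⟨x₁, y₁, h₁⟩
  · rw [← Point.zero_def] at *
    rw [sub_zero] at hPQ
    rw [zero_add]
    rcases Q with _ | ⟨x₂, y₂, h₂⟩
    · exact absurd (RepX.zero_left_iff.1 hPQ).2 hZ
    · obtain ⟨hX1, rfl⟩ := RepX.zero_left_iff.1 hP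
      obtain ⟨hZ2, rfl⟩ := RepX.some_iff.1 hQ
      obtain ⟨-, rfl⟩ := RepX.some_iff.1 hPQ
      rw [RepX.some_iff]
      constructor
      · simp_all
      · ring
  rcases Q with _ | ⟨x₂, y₂, h₂⟩
  · rw [← Point.zero_def] at *
    rw [zero_sub] at hPQ
    rw [add_zero]
    obtain ⟨hX1, rfl⟩ := RepX.zero_left_iff.1 hQ
    obtain ⟨hZ2, rfl⟩ := RepX.some_iff.1 hP
    have hPQ' := hPQ.neg
    rw [neg_neg] at hPQ'
    obtain ⟨-, rfl⟩ := RepX.some_iff.1 hPQ'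
    rw [RepX.some_iff]
    constructor
    · simp_all
    · ring
  have e₁ := (twoTorsionCurve_nonsingular h2 hb hab).1 h₁
  have e₂ := (twoTorsionCurve_nonsingular h2 hb hab).1 h₂
  obtain ⟨hZ1, rfl⟩ := RepX.some_iff.1 hP
  obtain ⟨hZ2, rfl⟩ := RepX.some_iff.1 hQ
  by_cases hx : x₁ = x₂
  · rcases Point.X_eq_iff (h₁ := h₁) (h₂ := h₂) |>.1 hx with h | h
    · rw [h, sub_self] at hPQ
      exact absurd (RepX.zero_left_iff.1 hPQ).2 hZ
    · rw [h, neg_add_cancel, RepX.zero_left_iff]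
      subst hx
      refine ⟨?_, by ring⟩
      rw [h, sub_neg_eq_add] at hPQ
      -- Here P = -Q and Q - P = 2Q. If the new numerator vanished, x² = b would make the numerator
      -- of x(2Q) zero; as X ≠ 0, its denominator would vanish as well, which is impossible.
      have key := hPQ.mul_eq_mul (RepX.dbl h2 hb hab hQ)
      intro h0
      have h3 : (x₁ * Z₂) ^ 2 - b * Z₂ ^ 2 = 0 := by
        have := (pow_eq_zero_iff two_ne_zero).1 ((mul_eq_zero.1 h0).resolve_left hZ)
        have h4 : Z₁ * Z₂ * (x₁ ^ 2 - b) = 0 := by linear_combination this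
        have h5 := (mul_eq_zero.1 h4).resolve_left (mul_ne_zero hZ1 hZ2)
        linear_combination Z₂ ^ 2 * h5
      have hdd := RepX.dbl h2 hb hab hQ
      rw [h3] at key hdd
      have h6 := (mul_eq_zero.1 (key.trans (by ring))).resolve_left hX
      rw [h6] at hdd
      obtain ⟨c, hc, h7, h8⟩ := hdd
      have h9 := Point.xRep_ne_zero (Point.some x₁ y₂ h₂ + Point.some x₁ y₂ h₂)
      apply h9
      ext i
      fin_cases i
      · simpa [hc] using h7
      · simpa [hc] using h8
  · rw [sub_eq_add_neg, Point.neg_some, Point.add_of_X_ne (Ne.symm hx), RepX.some_iff] at hPQ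
    rw [Point.add_of_X_ne hx, RepX.some_iff]
    obtain ⟨-, hPQ⟩ := hPQ
    have hx' : x₁ - x₂ ≠ 0 := sub_ne_zero.2 hx
    have hx'' : x₂ - x₁ ≠ 0 := sub_ne_zero.2 (Ne.symm hx)
    refine ⟨mul_ne_zero hX (pow_ne_zero _ ?_), ?_⟩
    · rw [show x₁ * Z₁ * Z₂ - x₂ * Z₂ * Z₁ = (x₁ - x₂) * (Z₁ * Z₂) by ring]
      exact mul_ne_zero hx' (mul_ne_zero hZ1 hZ2)
    · have hl : (twoTorsionCurve a b).slope x₁ x₂ y₁ y₂ * (x₁ - x₂) = y₁ - y₂ := by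
        rw [slope_of_X_ne hx, div_mul_cancel₀ _ hx']
      have hl' : (twoTorsionCurve a b).slope x₂ x₁ y₂ ((twoTorsionCurve a b).negY x₁ y₁)
          * (x₁ - x₂) = -(y₁ + y₂) := by
        rw [slope_of_X_ne (Ne.symm hx), twoTorsionCurve_negY]
        rw [show x₂ - x₁ = -(x₁ - x₂) by ring]
        field_simp
        ring
      rw [hPQ]
      generalize (twoTorsionCurve a b).slope x₁ x₂ y₁ y₂ = l at hl ⊢
      generalize (twoTorsionCurve a b).slope x₂ x₁ y₂ ((twoTorsionCurve a b).negY x₁ y₁) = m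
        at hl' ⊢
      simp only [addX, twoTorsionCurve]
      apply mul_left_cancel₀ (pow_ne_zero 2 hx')
      have hA : (l ^ 2 - a - x₁ - x₂) * (x₁ - x₂) ^ 2
          = (y₁ - y₂) ^ 2 - (a + x₁ + x₂) * (x₁ - x₂) ^ 2 := by
        linear_combination (l * (x₁ - x₂) + (y₁ - y₂)) * hl
      have hB : (m ^ 2 - a - x₁ - x₂) * (x₁ - x₂) ^ 2
          = (y₁ + y₂) ^ 2 - (a + x₁ + x₂) * (x₁ - x₂) ^ 2 := by
        linear_combination (m * (x₁ - x₂) - (y₁ + y₂)) * hl'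
      -- The factors are (x₁ - x₂)² x(P + Q) and (x₁ - x₂)² x(P - Q); their product involves y₁ and
      -- y₂ only through their squares.
      have hAB : ((y₁ - y₂) ^ 2 - (a + x₁ + x₂) * (x₁ - x₂) ^ 2) *
          ((y₁ + y₂) ^ 2 - (a + x₁ + x₂) * (x₁ - x₂) ^ 2)
          = (x₁ - x₂) ^ 2 * (x₁ * x₂ - b) ^ 2 := by
        linear_combination (y₁ ^ 2 - y₂ ^ 2 + x₁ * (x₁ ^ 2 + a * x₁ + b)
          - x₂ * (x₂ ^ 2 + a * x₂ + b) - 2 * (a + x₁ + x₂) * (x₁ - x₂) ^ 2) * e₁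
          + (-(y₁ ^ 2 - y₂ ^ 2 + x₁ * (x₁ ^ 2 + a * x₁ + b)
          - x₂ * (x₂ ^ 2 + a * x₂ + b)) - 2 * (a + x₁ + x₂) * (x₁ - x₂) ^ 2) * e₂
      rw [← hA, ← hB] at hAB
      linear_combination -Z * Z₁ ^ 2 * Z₂ ^ 2 * hAB

end TwoTorsionCurve

/-! ### Integer algorithms evaluated by the kernel -/

noncomputable section

/-- Application of a function to a natural number, which the kernel evaluates call-by-value. -/
def strictApply {α : Type*} (x : ℕ) (f : ℕ → α) : α :=
  Nat.rec (f 0) (fun k _ => f k.succ) x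

theorem strictApply_eq {α : Type*} (x : ℕ) (f : ℕ → α) : strictApply x f = f x := by
  cases x <;> rfl

/-- Two points on the projective line, the state of a Montgomery ladder. -/
structure XPairs where
  /-- The numerator of the first point. -/
  X₁ : ℕ
  /-- The denominator of the first point. -/
  Z₁ : ℕ
  /-- The numerator of the second point. -/
  X₂ : ℕ
  /-- The denominator of the second point. -/
  Z₂ : ℕ

/-- The `x`-coordinate of `2 P` on `y² = x³ + a x² + b x` modulo `p`. -/
def xDouble {α : Type*} (p a b X Z : ℕ) (f : ℕ → ℕ → α) : α :=
  strictApply (X * X % p) fun u =>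
  strictApply (X * Z % p) fun w =>
  strictApply (b * (Z * Z % p) % p) fun v =>
  -- Since `v` is a residue below `p`, the subtraction is not truncated and represents `-v`.
  strictApply (u + (p - v)) fun d =>
  strictApply (d * d % p) fun X' =>
  strictApply (4 * w * ((u + a * w + v) % p) % p) fun Z' => f X' Z'

/-- The `x`-coordinate of `P + Q` on `y² = x³ + a x² + b x` modulo `p`, where `(X, Z)` is that of
`Q - P`. -/
def xDiffAdd {α : Type*} (p b X Z X₁ Z₁ X₂ Z₂ : ℕ) (f : ℕ → ℕ → α) : α :=
  strictApply (b * (Z₁ * Z₂ % p) % p) fun v =>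
  strictApply (X₁ * X₂ + (p - v)) fun d =>
  strictApply (X₁ * Z₂ + (p - X₂ * Z₁ % p)) fun e =>
  strictApply (Z * (d * d % p) % p) fun X' =>
  strictApply (X * (e * e % p) % p) fun Z' => f X' Z'

/-- One step of the Montgomery ladder, from `(k P, (k + 1) P)` to
`((2 k + i) P, (2 k + i + 1) P)`, where `i` is `0` or `1`. -/
def ladderStep (p a b x i : ℕ) (s : XPairs) : XPairs :=
  XPairs.rec (fun X₁ Z₁ X₂ Z₂ =>
    xDiffAdd p b x 1 X₁ Z₁ X₂ Z₂ fun X Z =>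
      Nat.rec (xDouble p a b X₁ Z₁ fun X' Z' => ⟨X', Z', X, Z⟩)
        (fun _ _ => xDouble p a b X₂ Z₂ fun X' Z' => ⟨X, Z, X', Z'⟩) i) s

/-- The steps of the Montgomery ladder for the `2 ^ d` lowest binary digits of `n`. -/
def ladderRun (p a b x d : ℕ) : ℕ → XPairs → XPairs :=
  Nat.rec (fun i s => ladderStep p a b x i s)
    (fun d r n s => strictApply (n / 2 ^ 2 ^ d) fun n₁ => strictApply (n % 2 ^ 2 ^ d) fun n₀ =>
      -- The higher half of the digits comes first. Destructuring its result forces that state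
      -- before the lower half starts, and halving keeps the recursion shallow.
      XPairs.rec (fun X₁ Z₁ X₂ Z₂ => r n₀ ⟨X₁, Z₁, X₂, Z₂⟩) (r n₁ s)) d

/-- The `x`-coordinate of `n P` on `y² = x³ + a x² + b x` modulo `p`, where `x` is that of `P` and
`n` has at most `2 ^ d` binary digits. -/
def xMul {α : Type*} (p a b x d n : ℕ) (f : ℕ → ℕ → α) : α :=
  XPairs.rec (fun X Z _ _ => f X Z) (ladderRun p a b x d n ⟨1, 0, x, 1⟩)

/-- Coprimality, as a Boolean. -/
def isCoprime (n p : ℕ) : Bool := Nat.beq (Nat.gcd n p) 1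

/-- With `R = n₁ P₁` and `S = n₂ P₂`, where `x₁` and `x₂` are the `x`-coordinates of `P₁` and `P₂`,
check that `R` has order `10` and `S` has order `5`, and that `S` is not a multiple of `R`. -/
def independenceCheck (p a b x₁ x₂ n₁ d₁ n₂ d₂ : ℕ) : Bool :=
  xMul p a b x₁ d₁ n₁ fun X Z =>
  xMul p a b x₂ d₂ n₂ fun X' Z' =>
  isCoprime X p && (isCoprime Z p && (isCoprime X' p && (isCoprime Z' p && (
    xDouble p a b X Z fun X₂ Z₂ =>
    xDouble p a b X₂ Z₂ fun X₄ Z₄ =>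
    xDiffAdd p b X Z X Z X₂ Z₂ fun X₃ Z₃ =>
    xDiffAdd p b X Z X₂ Z₂ X₃ Z₃ fun X₅ Z₅ =>
    xDouble p a b X' Z' fun X₂' Z₂' =>
    xDiffAdd p b X' Z' X' Z' X₂' Z₂' fun X₃' Z₃' =>
    xDiffAdd p b X' Z' X₂' Z₂' X₃' Z₃' fun _ Z₅' =>
    isCoprime Z₂ p && (isCoprime Z₅ p && (Nat.beq X₅ 0 && (Nat.beq Z₅' 0 && (
      isCoprime (X' * Z₂ + (p - X₂ * Z' % p)) p &&
      isCoprime (X' * Z₄ + (p - X₄ * Z' % p)) p))))))))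

/-- Check that `n P` is not zero, where `x` is the `x`-coordinate of `P`. -/
def nonzeroCheck (p a b x n d : ℕ) : Bool :=
  xMul p a b x d n fun _ Z => isCoprime Z p

/-- The number `(u - 1) (128 - 2 u²⁴)` modulo `p`. -/
def coeffA (p u : ℕ) : ℕ := (u + (p - 1)) * (128 + 2 * (p - u ^ 24 % p)) % p

/-- The number `(u - 1)² u²⁴ (u²⁴ - 64)` modulo `p`. -/
def coeffB (p u : ℕ) : ℕ := (u + (p - 1)) ^ 2 * (u ^ 24 % p * (u ^ 24 % p + (p - 64))) % p

end

/-! ### Passage from residues modulo p to rings in which p = 0 -/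

section CastMod

variable {R : Type*} [Ring R] {p : ℕ}

/-- Only the vanishing of p in R is assumed, so that computations modulo p can be read in 𝔽_q for
every prime q dividing p, before p is known to be prime. -/
theorem cast_mod_of_cast_eq_zero (hp : (p : R) = 0) (n : ℕ) : ((n % p : ℕ) : R) = n := by
  conv_rhs => rw [← Nat.mod_add_div n p]
  simp [hp]

theorem cast_sub_mod_of_cast_eq_zero (hp0 : 0 < p) (hp : (p : R) = 0) (n : ℕ) :
    ((p - n % p : ℕ) : R) = -n := by
  rw [Nat.cast_sub (Nat.mod_lt n hp0).le, cast_mod_of_cast_eq_zero hp, hp, zero_sub]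

/-- By Bézout, n is invertible in R. This is why the checks test coprimality instead of a nonzero
residue. -/
theorem cast_ne_zero_of_isCoprime [Nontrivial R] (hp : (p : R) = 0) {n : ℕ} (h : isCoprime n p = true) :
    (n : R) ≠ 0 := by
  intro hn
  have h1 : Nat.gcd n p = 1 := Nat.eq_of_beq_eq_true h
  have h2 := congrArg (Int.cast (R := R)) (Nat.gcd_eq_gcd_ab n p)
  rw [h1] at h2
  push_cast at h2
  rw [hp, hn] at h2
  simp at h2

end CastMod

/-! ### Correctness of the Montgomery ladder and of the checks -/

section Ladder

variable {F : Type*} [Field F] [DecidableEq F] {p a b : ℕ}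

open WeierstrassCurve.Affine

/-- The algorithms are in continuation-passing style. Quantifying over all continuations `f` allows
the result to be substituted inside any later check. -/
theorem xDouble_rep (hp0 : 0 < p) (hp : (p : F) = 0) (h2 : (2 : F) ≠ 0) (hb : (b : F) ≠ 0)
    (hab : (a : F) ^ 2 - 4 * b ≠ 0) {P : (twoTorsionCurve (a : F) b).Point} {X Z : ℕ}
    (h : RepX P (X : F) Z) :
    ∃ X' Z' : ℕ, (∀ (α : Type) (f : ℕ → ℕ → α), xDouble p a b X Z f = f X' Z') ∧
      RepX (P + P) (X' : F) Z' := by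
  refine ⟨xDouble p a b X Z fun X' _ => X', xDouble p a b X Z fun _ Z' => Z',
    fun α f => by simp only [xDouble, strictApply_eq], ?_⟩
  simp only [xDouble, strictApply_eq]
  convert h.dbl h2 hb hab using 1
  · simp only [cast_mod_of_cast_eq_zero hp, cast_sub_mod_of_cast_eq_zero hp0 hp, Nat.cast_mul,
      Nat.cast_add]
    ring
  · simp only [cast_mod_of_cast_eq_zero hp, Nat.cast_mul, Nat.cast_add, Nat.cast_ofNat]
    ring

theorem xDiffAdd_rep (hp0 : 0 < p) (hp : (p : F) = 0) (h2 : (2 : F) ≠ 0) (hb : (b : F) ≠ 0)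
    (hab : (a : F) ^ 2 - 4 * b ≠ 0) {P Q : (twoTorsionCurve (a : F) b).Point}
    {X₁ Z₁ X₂ Z₂ X Z : ℕ} (hP : RepX P (X₁ : F) Z₁)
    (hQ : RepX Q (X₂ : F) Z₂) (hPQ : RepX (Q - P) (X : F) Z) (hX : (X : F) ≠ 0)
    (hZ : (Z : F) ≠ 0) :
    ∃ X' Z' : ℕ, (∀ (α : Type) (f : ℕ → ℕ → α), xDiffAdd p b X Z X₁ Z₁ X₂ Z₂ f = f X' Z') ∧
      RepX (P + Q) (X' : F) Z' := by
  refine ⟨xDiffAdd p b X Z X₁ Z₁ X₂ Z₂ fun X' _ => X', xDiffAdd p b X Z X₁ Z₁ X₂ Z₂ fun _ Z' => Z',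
    fun α f => by simp only [xDiffAdd, strictApply_eq], ?_⟩
  simp only [xDiffAdd, strictApply_eq]
  convert hP.diffAdd h2 hb hab hQ hPQ hX hZ using 1
  · simp only [cast_mod_of_cast_eq_zero hp, cast_sub_mod_of_cast_eq_zero hp0 hp, Nat.cast_mul,
      Nat.cast_add]
    ring
  · simp only [cast_mod_of_cast_eq_zero hp, cast_sub_mod_of_cast_eq_zero hp0 hp, Nat.cast_mul,
      Nat.cast_add]
    ring

/-- The state `s` of the ladder consists of the `x`-coordinates of `k P` and `(k + 1) P`. -/
def XPairs.Rep {W : WeierstrassCurve.Affine F} (s : XPairs) (P : W.Point) (k : ℕ) : Prop :=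
  RepX (k • P) (s.X₁ : F) s.Z₁ ∧ RepX ((k + 1) • P) (s.X₂ : F) s.Z₂

variable {x : ℕ} {P : (twoTorsionCurve (a : F) b).Point}

/-- The two points of the state always differ by P, whose x-coordinate is finite and nonzero, so
differential addition applies at every step. -/
theorem ladderStep_rep (hp0 : 0 < p) (hp : (p : F) = 0) (h2 : (2 : F) ≠ 0) (hb : (b : F) ≠ 0)
    (hab : (a : F) ^ 2 - 4 * b ≠ 0) (hP : RepX P (x : F) 1) (hx : (x : F) ≠ 0) {s : XPairs}
    {k i : ℕ} (hi : i < 2) (h : s.Rep P k) : (ladderStep p a b x i s).Rep P (k * 2 + i) := by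
  obtain ⟨X₁, Z₁, X₂, Z₂⟩ := s
  obtain ⟨h₁, h₂⟩ := h
  obtain ⟨X, Z, e, hXZ⟩ := xDiffAdd_rep (Z := 1) hp0 hp h2 hb hab h₁ h₂
    (by rw [add_smul, one_smul, add_sub_cancel_left, Nat.cast_one]; exact hP) hx (by simp)
  have hk : k • P + (k + 1) • P = (k * 2 + 1) • P := by
    rw [← add_smul]; congr 1; ring
  rw [hk] at hXZ
  simp only [ladderStep, e]
  interval_cases i
  · obtain ⟨X', Z', e', hXZ'⟩ := xDouble_rep hp0 hp h2 hb hab h₁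
    simp only [e']
    change XPairs.Rep ⟨X', Z', X, Z⟩ P _
    refine ⟨?_, hXZ⟩
    rw [← add_smul] at hXZ'
    convert hXZ' using 2
    ring
  · obtain ⟨X', Z', e', hXZ'⟩ := xDouble_rep hp0 hp h2 hb hab h₂
    simp only [e']
    change XPairs.Rep ⟨X, Z, X', Z'⟩ P _
    refine ⟨hXZ, ?_⟩
    rw [← add_smul] at hXZ'
    convert hXZ' using 2
    ring

theorem ladderRun_rep (hp0 : 0 < p) (hp : (p : F) = 0) (h2 : (2 : F) ≠ 0) (hb : (b : F) ≠ 0)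
    (hab : (a : F) ^ 2 - 4 * b ≠ 0) (hP : RepX P (x : F) 1) (hx : (x : F) ≠ 0) (d : ℕ) {s : XPairs}
    {k n : ℕ} (hn : n < 2 ^ 2 ^ d) (h : s.Rep P k) :
    (ladderRun p a b x d n s).Rep P (k * 2 ^ 2 ^ d + n) := by
  induction d generalizing s k n with
  | zero =>
    simpa [ladderRun] using ladderStep_rep hp0 hp h2 hb hab hP hx (by simpa using hn) h
  | succ d ih =>
    have e : ladderRun p a b x (d + 1) n s
        = ladderRun p a b x d (n % 2 ^ 2 ^ d) (ladderRun p a b x d (n / 2 ^ 2 ^ d) s) := by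
      simp only [ladderRun, strictApply_eq]
    rw [e]
    have hpos : 0 < 2 ^ 2 ^ d := by positivity
    have := ih (Nat.mod_lt n hpos) (ih (n := n / 2 ^ 2 ^ d) (by
      rw [Nat.div_lt_iff_lt_mul hpos]
      convert hn using 1
      ring) h)
    convert this using 1
    rw [add_mul, add_assoc, mul_comm (n / _), Nat.div_add_mod]
    ring

theorem xMul_rep (hp0 : 0 < p) (hp : (p : F) = 0) (h2 : (2 : F) ≠ 0) (hb : (b : F) ≠ 0)
    (hab : (a : F) ^ 2 - 4 * b ≠ 0) (hP : RepX P (x : F) 1) (hx : (x : F) ≠ 0) {d n : ℕ}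
    (hn : n < 2 ^ 2 ^ d) :
    ∃ X' Z' : ℕ, (∀ (α : Type) (f : ℕ → ℕ → α), xMul p a b x d n f = f X' Z') ∧
      RepX (n • P) (X' : F) Z' := by
  have h := ladderRun_rep (s := ⟨1, 0, x, 1⟩) (k := 0) hp0 hp h2 hb hab hP hx d hn
    ⟨by rw [zero_smul]; exact RepX.zero_left_iff.2 (by simp), by simpa using hP⟩
  refine ⟨(ladderRun p a b x d n ⟨1, 0, x, 1⟩).X₁, (ladderRun p a b x d n ⟨1, 0, x, 1⟩).Z₁,
    fun α f => rfl, ?_⟩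
  simpa using h.1

theorem smul_ne_zero_of_nonzeroCheck (hp0 : 0 < p) (hp : (p : F) = 0) (h2 : (2 : F) ≠ 0)
    (hb : (b : F) ≠ 0) (hab : (a : F) ^ 2 - 4 * b ≠ 0) (hP : RepX P (x : F) 1) (hx : (x : F) ≠ 0)
    {d n : ℕ} (hn : n < 2 ^ 2 ^ d) (h : nonzeroCheck p a b x n d = true) : n • P ≠ 0 := by
  obtain ⟨X', Z', e, hXZ⟩ := xMul_rep hp0 hp h2 hb hab hP hx hn
  rw [nonzeroCheck, e] at h
  rw [Ne, hXZ.zero_iff]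
  exact cast_ne_zero_of_isCoprime hp h

/-- With R = n₁P and S = n₂Q, the multiples 3R = R + 2R and 5R = 2R + 3R have known difference R,
and likewise for S. Unequal x-coordinates of S and T exclude both S = T and S = -T, so comparing
with 2R and 4R is enough to separate S from ⟨2R⟩. -/
theorem independenceCheck_sound (hp0 : 0 < p) (hp : (p : F) = 0) (h2 : (2 : F) ≠ 0)
    (hb : (b : F) ≠ 0) (hab : (a : F) ^ 2 - 4 * b ≠ 0) {x₁ x₂ n₁ d₁ n₂ d₂ : ℕ}
    {P Q : (twoTorsionCurve (a : F) b).Point}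
    (hP : RepX P (x₁ : F) 1) (hx₁ : (x₁ : F) ≠ 0) (hn₁ : n₁ < 2 ^ 2 ^ d₁)
    (hQ : RepX Q (x₂ : F) 1) (hx₂ : (x₂ : F) ≠ 0) (hn₂ : n₂ < 2 ^ 2 ^ d₂)
    (h : independenceCheck p a b x₁ x₂ n₁ d₁ n₂ d₂ = true) :
    (2 * n₁) • P ≠ 0 ∧ (5 * n₁) • P ≠ 0 ∧ (10 * n₁) • P = 0 ∧ n₂ • Q ≠ 0 ∧ (5 * n₂) • Q = 0 ∧
      n₂ • Q ≠ (2 * n₁) • P ∧ n₂ • Q ≠ -((2 * n₁) • P) ∧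
      n₂ • Q ≠ (4 * n₁) • P ∧ n₂ • Q ≠ -((4 * n₁) • P) := by
  simp only [mul_smul]
  obtain ⟨X, Z, e, hR⟩ := xMul_rep hp0 hp h2 hb hab hP hx₁ hn₁
  obtain ⟨X', Z', e', hS⟩ := xMul_rep hp0 hp h2 hb hab hQ hx₂ hn₂
  generalize n₁ • P = R at *
  generalize n₂ • Q = S at *
  rw [independenceCheck, e, e'] at h
  have nz := fun n => cast_ne_zero_of_isCoprime (R := F) hp (n := n)
  rw [Bool.and_eq_true, Bool.and_eq_true, Bool.and_eq_true, Bool.and_eq_true] at h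
  obtain ⟨hX, hZ, hX', hZ', h⟩ := h
  replace hX := nz _ hX
  replace hZ := nz _ hZ
  replace hX' := nz _ hX'
  replace hZ' := nz _ hZ'
  obtain ⟨X2, Z2, e2, hR2⟩ := xDouble_rep hp0 hp h2 hb hab hR
  obtain ⟨X4, Z4, e4, hR4⟩ := xDouble_rep hp0 hp h2 hb hab hR2
  obtain ⟨X2', Z2', e2', hS2⟩ := xDouble_rep hp0 hp h2 hb hab hS
  obtain ⟨X3, Z3, e3, hR3⟩ := xDiffAdd_rep hp0 hp h2 hb hab hR hR2 (by simpa using hR) hX hZ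
  obtain ⟨X5, Z5, e5, hR5⟩ := xDiffAdd_rep hp0 hp h2 hb hab hR2 hR3 (by simpa using hR) hX hZ
  obtain ⟨X3', Z3', e3', hS3⟩ := xDiffAdd_rep hp0 hp h2 hb hab hS hS2 (by simpa using hS) hX' hZ'
  obtain ⟨X5', Z5', e5', hS5⟩ := xDiffAdd_rep hp0 hp h2 hb hab hS2 hS3 (by simpa using hS) hX' hZ'
  rw [e2, e4, e3, e5, e2', e3', e5'] at h
  simp only [Bool.and_eq_true] at h
  obtain ⟨c1, c3, c2, c4, c5, c6⟩ := h
  have two : ∀ T : (twoTorsionCurve (a : F) b).Point, 2 • T = T + T := fun T => two_smul ℕ T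
  have four : ∀ T : (twoTorsionCurve (a : F) b).Point, 4 • T = (T + T) + (T + T) :=
    fun T => by abel
  have five : ∀ T : (twoTorsionCurve (a : F) b).Point, 5 • T = (T + T) + (T + (T + T)) :=
    fun T => by abel
  have ten : ∀ T : (twoTorsionCurve (a : F) b).Point, 10 • T = 5 • T + 5 • T :=
    fun T => by abel
  rw [ten, five R, five S, four, two]
  have key : ∀ (T : (twoTorsionCurve (a : F) b).Point) (U V : ℕ), RepX T (U : F) V →
      isCoprime (X' * V + (p - U * Z' % p)) p = true → S ≠ T ∧ S ≠ -T := by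
    intro T U V hT hc
    have hne := nz _ hc
    push_cast at hne
    rw [cast_sub_mod_of_cast_eq_zero hp0 hp] at hne
    constructor
    · rintro rfl
      apply hne
      rw [hS.mul_eq_mul hT]
      push_cast
      ring
    · intro e
      rw [e] at hS
      apply hne
      rw [hS.mul_eq_mul hT.neg]
      push_cast
      ring
  have hX5 : X5 = 0 := Nat.eq_of_beq_eq_true c2
  have hZ5' : Z5' = 0 := Nat.eq_of_beq_eq_true c4
  refine ⟨?_, ?_, ?_, ?_, ?_, (key _ _ _ hR2 c5).1, (key _ _ _ hR2 c5).2,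
    (key _ _ _ hR4 c6).1, (key _ _ _ hR4 c6).2⟩
  · rw [Ne, hR2.zero_iff]; exact nz _ c1
  · rw [Ne, hR5.zero_iff]; exact nz _ c3
  -- The check found x(5R) = 0, so 5R is the 2-torsion point (0, 0): the doubled denominator has the
  -- factor X.
  · rw [RepX.zero_iff (RepX.dbl h2 hb hab hR5), hX5]
    simp
  · rw [Ne, hS.zero_iff]; exact hZ'
  · rw [hS5.zero_iff, hZ5']
    simp

end Ladder

/-! ### A divisor of the group order from two independent points -/

section GroupTheory

/-- The order of P is 10n and that of Q is 5^(f+1). If ⟨P⟩ and ⟨Q⟩ met nontrivially, they would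
share a subgroup of order 5, and (5^f)Q would be one of the multiples of (2n)P that the hypotheses
exclude. So ⟨P⟩ × ⟨Q⟩ embeds in G, and Lagrange's theorem applies. -/
theorem card_dvd_of_independent {G : Type*} [AddCommGroup G] [Finite G] {P Q : G} {n e f k : ℕ}
    (h2 : (2 * n) • P ≠ 0) (h5 : (5 * n) • P ≠ 0) (h10 : (10 * n) • P = 0)
    (hQ : (5 ^ f) • Q ≠ 0) (hQ5 : (5 * 5 ^ f) • Q = 0) (hn : n = 2 ^ e * 5 ^ k)
    (i1 : (5 ^ f) • Q ≠ (2 * n) • P) (i2 : (5 ^ f) • Q ≠ -((2 * n) • P))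
    (i3 : (5 ^ f) • Q ≠ (4 * n) • P) (i4 : (5 ^ f) • Q ≠ -((4 * n) • P)) :
    (10 * n) * (5 * 5 ^ f) ∣ Nat.card G := by
  have : Fact (Nat.Prime 5) := ⟨Nat.prime_five⟩
  have hoQ : addOrderOf Q = 5 * 5 ^ f := by
    rw [mul_comm, ← pow_succ] at hQ5 ⊢
    exact addOrderOf_eq_prime_pow hQ hQ5
  have hoP : addOrderOf P = 10 * n := by
    subst hn
    refine addOrderOf_eq_of_nsmul_and_div_prime_nsmul (by positivity) h10 ?_
    intro q hq hqd
    have hq' : q = 2 ∨ q = 5 := by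
      have h1 : q ∣ 2 ^ (e + 1) * 5 ^ (k + 1) := by
        convert hqd using 1; ring
      rcases (Nat.Prime.dvd_mul hq).1 h1 with h | h
      · exact Or.inl ((Nat.prime_dvd_prime_iff_eq hq Nat.prime_two).1 (hq.dvd_of_dvd_pow h))
      · exact Or.inr ((Nat.prime_dvd_prime_iff_eq hq Nat.prime_five).1 (hq.dvd_of_dvd_pow h))
    rcases hq' with rfl | rfl
    · convert h5 using 2; omega
    · convert h2 using 2; omega
  have hdisj : Disjoint (AddSubgroup.zmultiples P) (AddSubgroup.zmultiples Q) := by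
    rw [disjoint_iff, ← AddSubgroup.card_eq_one]
    by_contra hcard
    set H := AddSubgroup.zmultiples P ⊓ AddSubgroup.zmultiples Q
    have h5H : 5 ∣ Nat.card H := by
      have h1 : Nat.card H ∣ 5 ^ (f + 1) := by
        rw [pow_succ', ← hoQ, ← Nat.card_zmultiples]
        exact AddSubgroup.card_dvd_of_le inf_le_right
      obtain ⟨m, -, hm⟩ := (Nat.dvd_prime_pow Nat.prime_five).1 h1
      rw [hm] at hcard ⊢
      exact dvd_pow_self 5 (by rintro rfl; exact hcard (pow_zero 5))
    obtain ⟨⟨y, hyH⟩, hy⟩ := exists_prime_addOrderOf_dvd_card' 5 h5H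
    obtain ⟨hyP, hyQ⟩ := AddSubgroup.mem_inf.1 hyH
    rw [AddSubgroup.addOrderOf_mk] at hy
    obtain ⟨i, hi⟩ := AddSubgroup.mem_zmultiples_iff.1 hyP
    obtain ⟨j, hj⟩ := AddSubgroup.mem_zmultiples_iff.1 hyQ
    have h5y : (5 : ℤ) • y = 0 := by
      rw [← addOrderOf_dvd_iff_zsmul_eq_zero, hy]; norm_num
    -- From 5iP = 0 it follows that 10n divides 5i; thus y is a multiple of (2n)P, and similarly of
    -- (5^f)Q.
    have hi' : ((2 * n : ℕ) : ℤ) ∣ i := by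
      rw [← hi, smul_smul, ← addOrderOf_dvd_iff_zsmul_eq_zero, hoP] at h5y
      refine Int.dvd_of_mul_dvd_mul_left (a := 5) (by norm_num) ?_
      convert h5y using 1
      push_cast; ring
    have hj' : ((5 ^ f : ℕ) : ℤ) ∣ j := by
      rw [← hj, smul_smul, ← addOrderOf_dvd_iff_zsmul_eq_zero, hoQ] at h5y
      refine Int.dvd_of_mul_dvd_mul_left (a := 5) (by norm_num) ?_
      convert h5y using 1
      push_cast; ring
    obtain ⟨i, rfl⟩ := hi'
    obtain ⟨j, rfl⟩ := hj'
    have h4 : (4 * n) • P = (2 : ℤ) • (2 * n) • P := by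
      rw [← natCast_zsmul P, ← natCast_zsmul P, smul_smul]; push_cast; congr 1; ring
    rw [h4] at i3 i4
    have hR : (5 : ℤ) • (2 * n) • P = 0 := by
      rw [← h10, ← natCast_zsmul P, ← natCast_zsmul P, smul_smul]; push_cast; congr 1; ring
    have hS : (5 : ℤ) • (5 ^ f) • Q = 0 := by
      rw [← hQ5, ← natCast_zsmul Q, ← natCast_zsmul Q, smul_smul]; push_cast; rfl
    rw [mul_comm, mul_smul, natCast_zsmul] at hi hj
    generalize (2 * n) • P = R at *
    generalize (5 ^ f) • Q = S at *
    have hj5 : ¬ (5 : ℤ) ∣ j := by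
      rintro ⟨l, rfl⟩
      rw [mul_comm, mul_smul, hS, smul_zero] at hj
      rw [← hj, addOrderOf_zero] at hy
      norm_num at hy
    have red : ∀ (T : G) (l : ℤ), (5 : ℤ) • T = 0 → l • T = (l % 5) • T := by
      intro T l hT
      conv_lhs => rw [← Int.emod_add_mul_ediv l 5]
      rw [add_smul, mul_comm, mul_smul, hT, smul_zero, add_zero]
    -- As y ≠ 0, the coefficient j is invertible modulo 5, so the relation iR = jS can be solved for
    -- S.
    obtain ⟨m, hm⟩ : ∃ m, m * j % 5 = 1 := by
      have : j % 5 = 1 ∨ j % 5 = 2 ∨ j % 5 = 3 ∨ j % 5 = 4 := by omega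
      rcases this with h | h | h | h
      · exact ⟨1, by omega⟩
      · exact ⟨3, by omega⟩
      · exact ⟨2, by omega⟩
      · exact ⟨4, by omega⟩
    have hSR : S = (m * i % 5) • R := by
      rw [← red _ _ hR, mul_smul, hi, ← hj, ← mul_smul, red _ _ hS, hm, one_smul]
    have hlt := Int.emod_lt_of_pos (m * i) (b := 5) (by norm_num)
    have hnn := Int.emod_nonneg (m * i) (b := 5) (by norm_num)
    generalize m * i % 5 = c at *
    have hneg : ∀ l : ℤ, l • R = -((5 - l) • R) := by
      intro l
      rw [sub_smul, hR, zero_sub, neg_neg]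
    interval_cases c
    · exact hQ (by rw [hSR, zero_smul])
    · exact i1 (by rw [hSR, one_smul])
    · exact i3 hSR
    · exact i4 (by rw [hSR, hneg]; norm_num)
    · exact i2 (by rw [hSR, hneg]; norm_num)
  let φ : AddSubgroup.zmultiples P × AddSubgroup.zmultiples Q →+ G :=
    AddMonoidHom.coprod (AddSubgroup.subtype _) (AddSubgroup.subtype _)
  have hφ : Function.Injective φ := by
    rw [injective_iff_map_eq_zero]
    rintro ⟨⟨y, hy⟩, ⟨z, hz⟩⟩ h
    have h0 : y + z = 0 := h
    have hyz : y = -z := eq_neg_of_add_eq_zero_left h0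
    have hy0 : y = 0 := AddSubgroup.disjoint_def.1 hdisj hy (by rw [hyz]; exact neg_mem hz)
    have hz0 : z = 0 := by simpa [hy0] using h0
    simp [hy0, hz0]
  have := AddSubgroup.card_dvd_of_injective φ hφ
  rwa [Nat.card_prod, Nat.card_zmultiples, Nat.card_zmultiples, hoP, hoQ] at this

end GroupTheory

/-! ### Point counts as quadratic character sums -/

section CharacterSums

theorem ringChar_ne_two {R : Type*} [NonAssocSemiring R] (h2 : (2 : R) ≠ 0) : ringChar R ≠ 2 := by
  intro h
  apply h2
  have := ringChar.Nat.cast_ringChar (R := R)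
  rw [h] at this
  exact_mod_cast this

variable {F : Type*} [Field F] [Fintype F] [DecidableEq F]

theorem card_sq_eq (hF : ringChar F ≠ 2) (a : F) :
    (Nat.card {y : F // y ^ 2 = a} : ℤ) = quadraticChar F a + 1 := by
  rw [← quadraticChar_card_sqrts hF a, Nat.card_eq_fintype_card, Set.toFinset_card]
  rfl

theorem card_sq_eq_apply (hF : ringChar F ≠ 2) (g : F → F) :
    (Nat.card {P : F × F // P.2 ^ 2 = g P.1} : ℤ) =
      Fintype.card F + ∑ x, quadraticChar F (g x) := by
  have e : {P : F × F // P.2 ^ 2 = g P.1} ≃ Σ x : F, {y : F // y ^ 2 = g x} :=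
    { toFun := fun P => ⟨P.1.1, P.1.2, P.2⟩
      invFun := fun P => ⟨(P.1, P.2.1), P.2.2⟩
      left_inv := fun _ => rfl
      right_inv := fun _ => rfl }
  rw [Nat.card_congr e, Nat.card_sigma]
  push_cast
  simp only [card_sq_eq hF, Finset.sum_add_distrib]
  simp [add_comm]

instance finite_affinePoint (W : WeierstrassCurve.Affine F) : Finite W.Point :=
  Finite.of_equiv (Option {P : F × F // W.Nonsingular P.1 P.2})
    (WeierstrassCurve.Affine.nonsingularPointEquiv W).symm

variable {a b : F}

theorem card_twoTorsionCurve (h2 : (2 : F) ≠ 0) (hb : b ≠ 0) (hab : a ^ 2 - 4 * b ≠ 0) :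
    (Nat.card (twoTorsionCurve a b).Point : ℤ) =
      Fintype.card F + 1 + ∑ x, quadraticChar F (x * (x ^ 2 + a * x + b)) := by
  have e : {P : F × F // (twoTorsionCurve a b).Nonsingular P.1 P.2} ≃
      {P : F × F // P.2 ^ 2 = P.1 * (P.1 ^ 2 + a * P.1 + b)} :=
    Equiv.subtypeEquivRight fun P => twoTorsionCurve_nonsingular h2 hb hab
  have e' : (twoTorsionCurve a b).Point ≃ Option _ :=
    (WeierstrassCurve.Affine.nonsingularPointEquiv _).trans e.optionCongr
  rw [Nat.card_congr e', Finite.card_option, Nat.cast_add,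
    card_sq_eq_apply (ringChar_ne_two h2) fun x => x * (x ^ 2 + a * x + b)]
  push_cast
  ring

/-- Each character value is at most 1. This trivial bound replaces Hasse's theorem throughout. -/
theorem card_twoTorsionCurve_le (h2 : (2 : F) ≠ 0) (hb : b ≠ 0) (hab : a ^ 2 - 4 * b ≠ 0) :
    Nat.card (twoTorsionCurve a b).Point ≤ 2 * Fintype.card F + 1 := by
  zify
  rw [card_twoTorsionCurve h2 hb hab]
  have : ∑ x : F, quadraticChar F (x * (x ^ 2 + a * x + b)) ≤ ∑ x : F, (1 : ℤ) := by
    refine Finset.sum_le_sum fun x _ => ?_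
    by_cases h : x * (x ^ 2 + a * x + b) = 0
    · simp [h]
    · rcases quadraticChar_dichotomy h with h | h <;> simp [h]
  rw [Finset.sum_const, Finset.card_univ, nsmul_one] at this
  linarith

theorem quadraticChar_neg (hneg : quadraticChar F (-1) = -1) (x : F) :
    quadraticChar F (-x) = -quadraticChar F x := by
  rw [← neg_one_mul, map_mul, hneg, neg_one_mul]

/-- Replacing x by -x turns the cubic for -a into minus the cubic for a. As -1 is a nonsquare, the
two curves are quadratic twists and their character sums cancel. -/
theorem card_twoTorsionCurve_neg (h2 : (2 : F) ≠ 0) (hb : b ≠ 0) (hab : a ^ 2 - 4 * b ≠ 0)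
    (hneg : quadraticChar F (-1) = -1) :
    Nat.card (twoTorsionCurve a b).Point + Nat.card (twoTorsionCurve (-a) b).Point =
      2 * Fintype.card F + 2 := by
  zify
  rw [card_twoTorsionCurve h2 hb hab, card_twoTorsionCurve h2 hb (by simpa using hab)]
  have : ∑ x : F, quadraticChar F (x * (x ^ 2 + -a * x + b)) =
      -∑ x : F, quadraticChar F (x * (x ^ 2 + a * x + b)) := by
    rw [← Finset.sum_neg_distrib, ← Equiv.sum_comp (Equiv.neg F)]
    refine Finset.sum_congr rfl fun x _ => ?_
    rw [← quadraticChar_neg hneg]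
    refine congrArg (quadraticChar F) ?_
    simp only [Equiv.neg_apply]
    ring
  rw [this]
  ring

/-- The fibre of squaring over t has 1 + χ(t) elements. For an even sextic this splits the sum into
those of the two quotient curves. -/
theorem sum_comp_sq (hF : ringChar F ≠ 2) (g : F → ℤ) :
    ∑ x : F, g (x ^ 2) = ∑ t : F, (quadraticChar F t + 1) * g t := by
  rw [← Finset.sum_fiberwise (s := Finset.univ) (g := fun x : F => x ^ 2)]
  refine Finset.sum_congr rfl fun t _ => ?_
  rw [← card_sq_eq hF, Finset.sum_congr rfl (g := fun _ => g t) (by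
    intro x hx
    rw [(Finset.mem_filter.1 hx).2])]
  rw [Finset.sum_const, Nat.card_eq_fintype_card, Fintype.card_subtype]
  simp

/-- The character sum of the double cover `y² = d (x² + 8) (x⁴ + 16 x² + c)`, reduced to that of
its quotient by `(x, y) ↦ (-x, -y)`. -/
theorem sum_quadraticChar_sextic (h2 : (2 : F) ≠ 0) (hneg : quadraticChar F (-1) = -1) {d c : F}
    (hd : d ≠ 0) (hc : c ≠ 0) :
    ∑ x : F, quadraticChar F (d * (x ^ 2 + 8) * (x ^ 4 + 16 * x ^ 2 + c)) + quadraticChar F d =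
      ∑ x : F, quadraticChar F
        (x * (x ^ 2 + d * (128 - 2 * c) * x + d ^ 2 * (c * (c - 64)))) := by
  have hF := ringChar_ne_two h2
  set g : F → F := fun t => d * (t + 8) * (t ^ 2 + 16 * t + c) with hg
  have h1 : ∑ x : F, quadraticChar F (d * (x ^ 2 + 8) * (x ^ 4 + 16 * x ^ 2 + c)) =
      ∑ t : F, quadraticChar F (t * g t) + ∑ t : F, quadraticChar F (g t) := by
    have := sum_comp_sq hF (fun t => quadraticChar F (g t))
    simp only [add_mul, one_mul, Finset.sum_add_distrib, ← map_mul] at this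
    rw [← this]
    refine Finset.sum_congr rfl fun x _ => ?_
    refine congrArg (quadraticChar F) ?_
    simp only [hg]
    ring
  -- The reflection t ↦ -16 - t fixes t² + 16t and negates t + 8, so the sum equals its own
  -- negative.
  have h3 : ∑ t : F, quadraticChar F (g t) = 0 := by
    have e : ∑ t : F, quadraticChar F (g t) = -∑ t : F, quadraticChar F (g t) := by
      conv_lhs => rw [← (Equiv.subLeft (-16 : F)).sum_comp]
      rw [← Finset.sum_neg_distrib]
      refine Finset.sum_congr rfl fun x _ => ?_
      rw [← quadraticChar_neg hneg]
      congr 1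
      simp only [hg, Equiv.subLeft_apply]
      ring
    linarith
  set h : F → F := fun r => d * (1 + 8 * r) * (1 + 16 * r + c * r ^ 2) with hh
  -- Substitute t = 1/r away from 0, where t g(t) and h(r) differ by a square factor. At 0 the left
  -- summand vanishes and h(0) = d, which accounts for χ(d).
  have h4 : ∑ t : F, quadraticChar F (t * g t) + quadraticChar F d =
      ∑ r : F, quadraticChar F (h r) := by
    rw [← Finset.add_sum_erase _ _ (Finset.mem_univ (0 : F)),
      ← Finset.add_sum_erase (a := (0 : F)) Finset.univ (fun r => quadraticChar F (h r))
        (Finset.mem_univ (0 : F))]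
    have : ∑ x ∈ Finset.univ.erase (0 : F), quadraticChar F (x * g x) =
        ∑ x ∈ Finset.univ.erase (0 : F), quadraticChar F (h x) := by
      refine Finset.sum_bij' (fun x _ => x⁻¹) (fun x _ => x⁻¹) ?_ ?_ ?_ ?_ ?_
      · simp
      · simp
      · simp
      · simp
      · intro x hx
        have hx0 : x ≠ 0 := (Finset.mem_erase.1 hx).1
        have : x * g x = (x ^ 2) ^ 2 * h x⁻¹ := by
          simp only [hg, hh]
          field_simp
        rw [this, map_mul, quadraticChar_sq_one' (pow_ne_zero 2 hx0), one_mul]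
    rw [this]
    simp [hh]
  rw [h1, h3, add_zero, h4]
  have h8 : (8 : F) ≠ 0 := by
    rw [show (8 : F) = 2 ^ 3 by norm_num]; exact pow_ne_zero _ h2
  have hdc : d * c ≠ 0 := mul_ne_zero hd hc
  -- The affine change r ↦ dc(1 + 8r) moves the root of 1 + 8r to 0 and makes the cubic monic, up to
  -- the square (8dc)².
  let e : F ≃ F := (Equiv.mulLeft₀ (8 : F) h8).trans
    ((Equiv.addLeft (1 : F)).trans (Equiv.mulLeft₀ (d * c) hdc))
  conv_rhs => rw [← e.sum_comp]
  refine Finset.sum_congr rfl fun r _ => ?_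
  have he : e r = d * c * (1 + 8 * r) := rfl
  have : e r * (e r ^ 2 + d * (128 - 2 * c) * e r + d ^ 2 * (c * (c - 64))) =
      (8 * d * c) ^ 2 * h r := by
    rw [he]
    simp only [hh]
    ring
  rw [this, map_mul (quadraticChar F) (_ ^ 2), quadraticChar_sq_one', one_mul]
  exact mul_ne_zero (mul_ne_zero h8 hd) hc

end CharacterSums

/-! ### Rational points of the completed curve -/

namespace SexticCurve

variable {k : Type*} [Field k]

theorem eval_equation (f : k[X]) (P : Fin 3 → k) :
    MvPolynomial.eval P (equation f) =
      P 1 ^ 2 - ∑ i ∈ Finset.range 7, f.coeff i * P 0 ^ i * P 2 ^ (6 - i) := by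
  rw [equation, map_sub, map_pow, MvPolynomial.eval_X, MvPolynomial.eval_rename, homogenize,
    Finset.Nat.sum_antidiagonal_eq_sum_range_succ_mk, MvPolynomial.eval_sum]
  congr 1
  refine Finset.sum_congr rfl fun i _ => ?_
  rw [MvPolynomial.eval_monomial, Finsupp.update_eq_add_single, Finsupp.prod_add_index',
    Finsupp.prod_single_index, Finsupp.prod_single_index]
  · simp; ring
  all_goals simp [pow_add]

/-- Every class has a unique representative with Z = 1, or with Z = 0 and X = 1. In the latter case
the equation reads Y² = f₆, where f₆ is the coefficient of x⁶. -/
theorem card_point [Finite k] {f : k[X]} (hf : f.natDegree ≤ 6) :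
    Nat.card (Point f) = Nat.card {P : k × k // P.2 ^ 2 = f.eval P.1} +
      Nat.card {y : k // y ^ 2 = f.coeff 6} := by
  have hev : ∀ x, f.eval x = ∑ i ∈ Finset.range 7, f.coeff i * x ^ i := fun x =>
    Polynomial.eval_eq_sum_range' (Nat.lt_succ_iff.2 hf) x
  rw [← Nat.card_sum]
  symm
  let φ : {P : k × k // P.2 ^ 2 = f.eval P.1} ⊕ {y : k // y ^ 2 = f.coeff 6} → Solution f :=
    Sum.elim
      (fun P => ⟨![P.1.1, P.1.2, 1], fun h => one_ne_zero (congrFun h 2), by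
        rw [eval_equation]
        simpa [hev, sub_eq_zero] using P.2⟩)
      (fun y => ⟨![1, y.1, 0], fun h => one_ne_zero (congrFun h 0), by
        rw [eval_equation]
        simp [Finset.sum_range_succ, y.2]⟩)
  have hl : ∀ (x y : k) h, (φ (Sum.inl ⟨(x, y), h⟩)).1 = ![x, y, 1] := fun _ _ _ => rfl
  have hr : ∀ (y : k) h, (φ (Sum.inr ⟨y, h⟩)).1 = ![1, y, 0] := fun _ _ => rfl
  refine Nat.card_congr (Equiv.ofBijective (fun z => Quotient.mk (solutionSetoid f) (φ z)) ⟨?_, ?_⟩)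
  · intro z w hzw
    obtain ⟨c, hc⟩ : ∃ c : kˣ, (φ w).1 =
        ![c * (φ z).1 0, c ^ 3 * (φ z).1 1, c * (φ z).1 2] := Quotient.exact hzw
    have h0 := congrFun hc 0
    have h1 := congrFun hc 1
    have h2 := congrFun hc 2
    rcases z with ⟨⟨x, y⟩, hz⟩ | ⟨y, hz⟩ <;> rcases w with ⟨⟨x', y'⟩, hw⟩ | ⟨y', hw⟩ <;>
      simp only [hl, hr] at h0 h1 h2 <;> simp at h0 h1 h2
    · rw [← h2] at h0 h1
      simp [h0, h1]
    · exact absurd h2.symm c.ne_zero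
    · rw [← h0] at h1
      simp [h1]
  · intro Q
    induction Q using Quotient.inductionOn with
    | h Q =>
      obtain ⟨P, hP0, hP⟩ := Q
      rw [eval_equation] at hP
      by_cases hZ : P 2 = 0
      · have hX : P 0 ≠ 0 := by
          intro hX
          apply hP0
          ext i
          fin_cases i
          · exact hX
          · simpa [hZ, hX, Finset.sum_range_succ] using hP
          · exact hZ
        refine ⟨Sum.inr ⟨P 1 / P 0 ^ 3, ?_⟩, Quotient.sound ⟨Units.mk0 _ hX, ?_⟩⟩
        · simp [hZ, Finset.sum_range_succ] at hP
          field_simp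
          linear_combination hP
        · change P = _
          rw [hr]
          ext i
          fin_cases i
          · simp
          · simp; field_simp
          · simp [hZ]
      · refine ⟨Sum.inl ⟨(P 0 / P 2, P 1 / P 2 ^ 3), ?_⟩, Quotient.sound ⟨Units.mk0 _ hZ, ?_⟩⟩
        · rw [hev]
          simp only [Finset.sum_range_succ, Finset.sum_range_zero] at hP ⊢
          field_simp
          linear_combination hP
        · change P = _
          rw [hl]
          ext i
          fin_cases i
          · simp; field_simp
          · simp; field_simp
          · simp

end SexticCurve

/-! ### Čech cohomology of the structure sheaf -/

namespace SexticCurve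

variable {k : Type*} [Field k]

noncomputable section Overlap

open LaurentPolynomial (T)

theorem coeff_mul_T_of_mem_adjoin {s m j : ℤ} {x : LaurentPolynomial k}
    (hx : x ∈ Algebra.adjoin k {(T s : LaurentPolynomial k)}) (h : ∀ i : ℕ, i * s + m ≠ j) :
    (x * T m).coeff j = 0 := by
  rw [Algebra.adjoin_singleton_eq_range_aeval] at hx
  obtain ⟨p, rfl⟩ := hx
  change (aeval (T s : LaurentPolynomial k) p * T m).coeff j = 0
  rw [aeval_eq_sum_range, Finset.sum_mul]
  have : ∀ i, p.coeff i • (T s : LaurentPolynomial k) ^ i * T m = p.coeff i • T (i * s + m) := by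
    intro i
    rw [LaurentPolynomial.T_pow, smul_mul_assoc, ← LaurentPolynomial.T_add]
  simp only [this]
  simp [h]

theorem monic_overlap (f : k[X]) :
    (X ^ 2 - C (toLaurent f) : (LaurentPolynomial k)[X]).Monic :=
  monic_X_pow_sub_C _ two_ne_zero

/-- The coordinates of a function on the overlap with respect to the basis `1, y`. -/
def overlapCoord (f : k[X]) (i : ℕ) : OverlapRing f →ₗ[k] LaurentPolynomial k :=
  ((lcoeff (LaurentPolynomial k) i).comp (AdjoinRoot.modByMonicHom (monic_overlap f))).restrictScalars k

theorem overlapCoord_add_mul (f : k[X]) (a b : LaurentPolynomial k) :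
    overlapCoord f 0 (AdjoinRoot.of _ a + AdjoinRoot.of _ b * yFun f) = a ∧
    overlapCoord f 1 (AdjoinRoot.of _ a + AdjoinRoot.of _ b * yFun f) = b := by
  have e : AdjoinRoot.of _ a + AdjoinRoot.of _ b * yFun f = AdjoinRoot.mk _ (C a + C b * X) := by
    rw [map_add, map_mul, AdjoinRoot.mk_X]; rfl
  have e' : (C a + C b * X) %ₘ (X ^ 2 - C (toLaurent f)) = C a + C b * X := by
    rw [modByMonic_eq_self_iff (monic_overlap f), degree_X_pow_sub_C two_pos]
    refine lt_of_le_of_lt ?_ (show (1 : WithBot ℕ) < 2 by norm_num)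
    rw [add_comm]
    exact degree_linear_le
  simp only [overlapCoord, LinearMap.coe_restrictScalars, LinearMap.comp_apply, e,
    AdjoinRoot.modByMonicHom_mk, e', lcoeff_apply]
  simp

theorem overlap_eq (f : k[X]) (x : OverlapRing f) :
    x = AdjoinRoot.of _ (overlapCoord f 0 x) + AdjoinRoot.of _ (overlapCoord f 1 x) * yFun f := by
  have h := AdjoinRoot.mk_leftInverse (monic_overlap f) x
  set q := AdjoinRoot.modByMonicHom (monic_overlap f) x with hq
  have hdeg : q.degree < 2 := by
    obtain ⟨g, rfl⟩ := AdjoinRoot.mk_surjective x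
    rw [hq, AdjoinRoot.modByMonicHom_mk]
    exact (degree_modByMonic_lt _ (monic_overlap f)).trans_eq (degree_X_pow_sub_C two_pos _)
  have hq' : q = C (q.coeff 1) * X + C (q.coeff 0) := by
    refine eq_X_add_C_of_degree_le_one ?_
    exact Order.le_of_lt_succ hdeg
  have e0 : overlapCoord f 0 x = q.coeff 0 := rfl
  have e1 : overlapCoord f 1 x = q.coeff 1 := rfl
  rw [e0, e1, ← h]
  conv_lhs => rw [hq']
  rw [map_add, map_mul, AdjoinRoot.mk_X, add_comm]; rfl

theorem yFun_mul_self (f : k[X]) : yFun f * yFun f = AdjoinRoot.of _ (toLaurent f) := by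
  have := AdjoinRoot.mk_self (f := (X ^ 2 - C (toLaurent f) : (LaurentPolynomial k)[X]))
  rw [map_sub, map_pow, AdjoinRoot.mk_X, AdjoinRoot.mk_C, sub_eq_zero] at this
  rw [← pow_two]
  exact this

/-- The hypothesis says that (xᵐy)² lies in k[xˢ], so k[xˢ] + k[xˢ]xᵐy is closed under
multiplication. The pairs (s, m) = (1, 0) and (-1, -3) give the two charts. -/
theorem mem_adjoin_overlap {f : k[X]} {s m : ℤ}
    (hf : T (2 * m) * toLaurent f ∈ Algebra.adjoin k {(T s : LaurentPolynomial k)})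
    {x : OverlapRing f} :
    x ∈ Algebra.adjoin k {xPow f s, xPow f m * yFun f} ↔
      ∃ a ∈ Algebra.adjoin k {(T s : LaurentPolynomial k)},
      ∃ b ∈ Algebra.adjoin k {(T s : LaurentPolynomial k)},
        x = AdjoinRoot.of _ a + AdjoinRoot.of _ (b * T m) * yFun f := by
  constructor
  · intro hx
    induction hx using Algebra.adjoin_induction with
    | mem x hx =>
      rcases hx with rfl | hx
      · exact ⟨T s, Algebra.subset_adjoin rfl, 0, zero_mem _, by simp [xPow]⟩
      · rw [Set.mem_singleton_iff] at hx
        exact ⟨0, zero_mem _, 1, one_mem _, by simp [hx, xPow]⟩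
    | algebraMap r =>
      refine ⟨algebraMap k _ r, Subalgebra.algebraMap_mem _ r, 0, zero_mem _, ?_⟩
      rw [zero_mul, map_zero, zero_mul, add_zero]
      rfl
    | add x y _ _ hx hy =>
      obtain ⟨a, ha, b, hb, rfl⟩ := hx
      obtain ⟨c, hc, d, hd, rfl⟩ := hy
      refine ⟨a + c, add_mem ha hc, b + d, add_mem hb hd, ?_⟩
      simp only [map_add, add_mul]
      ring
    | mul x y _ _ hx hy =>
      obtain ⟨a, ha, b, hb, rfl⟩ := hx
      obtain ⟨c, hc, d, hd, rfl⟩ := hy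
      refine ⟨a * c + b * d * (T (2 * m) * toLaurent f),
        add_mem (mul_mem ha hc) (mul_mem (mul_mem hb hd) hf), a * d + b * c,
        add_mem (mul_mem ha hd) (mul_mem hb hc), ?_⟩
      rw [two_mul, LaurentPolynomial.T_add]
      simp only [map_add, map_mul, ← yFun_mul_self]
      ring
  · rintro ⟨a, ha, b, hb, rfl⟩
    have key : ∀ a ∈ Algebra.adjoin k {(T s : LaurentPolynomial k)},
        AdjoinRoot.of _ a ∈ Algebra.adjoin k {xPow f s, xPow f m * yFun f} := by
      intro a ha
      have h1 : AdjoinRoot.ofAlgHom k (X ^ 2 - C (toLaurent f)) a ∈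
          (Algebra.adjoin k {(T s : LaurentPolynomial k)}).map (AdjoinRoot.ofAlgHom k _) :=
        ⟨a, ha, rfl⟩
      rw [AlgHom.map_adjoin, Set.image_singleton] at h1
      exact Algebra.adjoin_mono (Set.singleton_subset_iff.2 (Set.mem_insert _ _)) h1
    rw [map_mul, mul_assoc]
    exact add_mem (key a ha) (mul_mem (key b hb) (Algebra.subset_adjoin (Or.inr rfl)))

theorem T_mem_adjoin {s : ℤ} (n : ℕ) :
    T (n * s) ∈ Algebra.adjoin k {(T s : LaurentPolynomial k)} := by
  rw [← LaurentPolynomial.T_pow]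
  exact pow_mem (Algebra.self_mem_adjoin_singleton k _) n

theorem toLaurent_eq_sum {f : k[X]} (hf : f.natDegree ≤ 6) :
    toLaurent f = ∑ i ∈ Finset.range 7, f.coeff i • (T i : LaurentPolynomial k) := by
  conv_lhs => rw [f.as_sum_range' 7 (Nat.lt_succ_iff.2 hf)]
  rw [map_sum]
  refine Finset.sum_congr rfl fun i _ => ?_
  rw [← C_mul_X_pow_eq_monomial, toLaurent_C_mul_X_pow, LaurentPolynomial.smul_eq_C_mul]

theorem mem_chartZ {f : k[X]} (hf : f.natDegree ≤ 6) {x : OverlapRing f} :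
    x ∈ chartZ f ↔ ∃ a ∈ Algebra.adjoin k {(T 1 : LaurentPolynomial k)},
      ∃ b ∈ Algebra.adjoin k {(T 1 : LaurentPolynomial k)},
        x = AdjoinRoot.of _ a + AdjoinRoot.of _ (b * T 0) * yFun f := by
  rw [← mem_adjoin_overlap, chartZ, Subalgebra.mem_toSubmodule]
  · simp [xPow]
  · rw [toLaurent_eq_sum hf]
    simp only [mul_zero, LaurentPolynomial.T_zero, one_mul]
    refine sum_mem fun i _ => Subalgebra.smul_mem _ ?_ _
    simpa using T_mem_adjoin (k := k) (s := 1) i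

theorem mem_chartX {f : k[X]} (hf : f.natDegree ≤ 6) {x : OverlapRing f} :
    x ∈ chartX f ↔ ∃ a ∈ Algebra.adjoin k {(T (-1) : LaurentPolynomial k)},
      ∃ b ∈ Algebra.adjoin k {(T (-1) : LaurentPolynomial k)},
        x = AdjoinRoot.of _ a + AdjoinRoot.of _ (b * T (-3)) * yFun f := by
  rw [← mem_adjoin_overlap, chartX, Subalgebra.mem_toSubmodule]
  rw [toLaurent_eq_sum hf, Finset.mul_sum]
  refine sum_mem fun i hi => ?_
  rw [mul_smul_comm, ← LaurentPolynomial.T_add]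
  refine Subalgebra.smul_mem _ ?_ _
  have := T_mem_adjoin (k := k) (s := -1) (6 - i)
  convert this using 2
  have := Finset.mem_range.1 hi
  push_cast [show i ≤ 6 by omega]
  ring

/-- In the basis 1, y the charts have coefficients in k[x], k[x] and in k[x⁻¹], x⁻³k[x⁻¹]. The
intersections are k for 1 and zero for y. -/
theorem h0_eq_one {f : k[X]} (hf : f.natDegree ≤ 6) : h0 f = 1 := by
  have : chartZ f ⊓ chartX f = Submodule.span k {1} := by
    apply le_antisymm
    · rintro x ⟨hZ, hX⟩
      obtain ⟨a, ha, b, hb, hab⟩ := (mem_chartZ hf).1 hZ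
      obtain ⟨a', ha', b', hb', hab'⟩ := (mem_chartX hf).1 hX
      have e := overlapCoord_add_mul f a (b * T 0)
      have e' := overlapCoord_add_mul f a' (b' * T (-3))
      rw [← hab] at e
      rw [← hab'] at e'
      have h1 : a = a' := e.1.symm.trans e'.1
      have h2 : b * T 0 = b' * T (-3) := e.2.symm.trans e'.2
      have hb0 : b * T 0 = 0 := by
        ext j
        by_cases hj : 0 ≤ j
        · rw [h2, coeff_mul_T_of_mem_adjoin hb' (fun i => by omega)]; simp
        · rw [coeff_mul_T_of_mem_adjoin hb (fun i => by omega)]; simp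
      have ha0 : a = LaurentPolynomial.C (a.coeff 0) := by
        ext j
        rw [LaurentPolynomial.C_apply]
        split_ifs with hj
        · rw [hj]
        · rcases lt_or_gt_of_ne hj with hj | hj
          · have := coeff_mul_T_of_mem_adjoin (m := 0) (j := j) ha (fun i => by omega)
            simpa using this
          · have := coeff_mul_T_of_mem_adjoin (m := 0) (j := j) ha' (fun i => by omega)
            simpa [h1] using this
      rw [Submodule.mem_span_singleton]
      refine ⟨a.coeff 0, ?_⟩
      rw [hab, hb0, RingHom.map_zero, zero_mul, add_zero]
      conv_rhs => rw [ha0]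
      rw [Algebra.smul_def, mul_one]
      rfl
    · rw [Submodule.span_singleton_le_iff_mem]
      exact ⟨one_mem (Algebra.adjoin k _), one_mem (Algebra.adjoin k _)⟩
  rw [h0, this]
  refine finrank_span_singleton (fun h => ?_)
  have h1 := overlapCoord_add_mul f 1 0
  rw [map_one, h] at h1
  have h2 := h1.1
  simp at h2

theorem exists_laurent_decomposition (b : LaurentPolynomial k) :
    ∃ p ∈ Algebra.adjoin k {(T 1 : LaurentPolynomial k)},
    ∃ q ∈ Algebra.adjoin k {(T (-1) : LaurentPolynomial k)},
      b = p * T 0 + (b.coeff (-1) • T (-1) + b.coeff (-2) • T (-2)) + q * T (-3) := by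
  induction b using LaurentPolynomial.induction_on' with
  | add b c hb hc =>
    obtain ⟨p, hp, q, hq, h⟩ := hb
    obtain ⟨p', hp', q', hq', h'⟩ := hc
    refine ⟨p + p', add_mem hp hp', q + q', add_mem hq hq', ?_⟩
    conv_lhs => rw [h, h']
    simp only [AddMonoidAlgebra.coeff_add, Finsupp.add_apply, add_smul, add_mul]
    abel
  | C_mul_T n c =>
    rw [← LaurentPolynomial.smul_eq_C_mul]
    by_cases h : 0 ≤ n
    · refine ⟨c • T n, Subalgebra.smul_mem _ ?_ _, 0, zero_mem _, ?_⟩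
      · have := T_mem_adjoin (k := k) (s := 1) n.toNat
        rwa [mul_one, Int.toNat_of_nonneg h] at this
      · simp [show n ≠ -1 by omega, show n ≠ -2 by omega]
    · by_cases h1 : n = -1
      · exact ⟨0, zero_mem _, 0, zero_mem _, by simp [h1]⟩
      · by_cases h2 : n = -2
        · exact ⟨0, zero_mem _, 0, zero_mem _, by simp [h2]⟩
        · refine ⟨0, zero_mem _, c • T (n + 3), Subalgebra.smul_mem _ ?_ _, ?_⟩
          · have := T_mem_adjoin (k := k) (s := -1) (-(n + 3)).toNat
            rwa [Int.toNat_of_nonneg (by omega), mul_neg_one, neg_neg] at this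
          · rw [smul_mul_assoc, ← LaurentPolynomial.T_add]
            simp [h1, h2]

/-- The charts together produce every monomial except x⁻¹y and x⁻²y. Hence their sum is the kernel
of the map ψ that reads those two coefficients. -/
theorem h1_eq_two {f : k[X]} (hf : f.natDegree ≤ 6) : h1 f = 2 := by
  let c : ℤ → OverlapRing f →ₗ[k] k := fun j =>
    { toFun := fun x => (overlapCoord f 1 x).coeff j
      map_add' := by simp
      map_smul' := by simp }
  let ψ : OverlapRing f →ₗ[k] k × k := (c (-1)).prod (c (-2))
  have hker : LinearMap.ker ψ = chartZ f ⊔ chartX f := by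
    apply le_antisymm
    · intro x hx
      have h1 : (overlapCoord f 1 x).coeff (-1) = 0 := congrArg Prod.fst hx
      have h2 : (overlapCoord f 1 x).coeff (-2) = 0 := congrArg Prod.snd hx
      obtain ⟨p, hp, q, hq, h⟩ := exists_laurent_decomposition (overlapCoord f 1 x)
      obtain ⟨p', hp', q', hq', h'⟩ := exists_laurent_decomposition (overlapCoord f 0 x)
      rw [h1, h2] at h
      rw [Submodule.mem_sup]
      refine ⟨_, (mem_chartZ hf).2 ⟨p', hp', p, hp, rfl⟩, _, (mem_chartX hf).2
        ⟨(overlapCoord f 0 x).coeff (-1) • T (-1) + (overlapCoord f 0 x).coeff (-2) • T (-2)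
          + q' * T (-3), ?_, q, hq, rfl⟩, ?_⟩
      · refine add_mem (add_mem (Subalgebra.smul_mem _ ?_ _) (Subalgebra.smul_mem _ ?_ _))
          (mul_mem hq' ?_)
        · exact Algebra.self_mem_adjoin_singleton k _
        · simpa using T_mem_adjoin (k := k) (s := -1) 2
        · simpa using T_mem_adjoin (k := k) (s := -1) 3
      · conv_rhs => rw [overlap_eq f x, h, h']
        simp only [map_add, LaurentPolynomial.T_zero, mul_one, zero_smul, add_zero]
        ring
    · rw [sup_le_iff]
      constructor
      · intro x hx
        obtain ⟨a, ha, b, hb, hab⟩ := (mem_chartZ hf).1 hx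
        have e := (overlapCoord_add_mul f a (b * T 0)).2
        rw [← hab] at e
        refine Prod.ext ?_ ?_
        · change (overlapCoord f 1 x).coeff (-1) = 0
          rw [e, coeff_mul_T_of_mem_adjoin hb (fun i => by omega)]
        · change (overlapCoord f 1 x).coeff (-2) = 0
          rw [e, coeff_mul_T_of_mem_adjoin hb (fun i => by omega)]
      · intro x hx
        obtain ⟨a, ha, b, hb, hab⟩ := (mem_chartX hf).1 hx
        have e := (overlapCoord_add_mul f a (b * T (-3))).2
        rw [← hab] at e
        refine Prod.ext ?_ ?_
        · change (overlapCoord f 1 x).coeff (-1) = 0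
          rw [e, coeff_mul_T_of_mem_adjoin hb (fun i => by omega)]
        · change (overlapCoord f 1 x).coeff (-2) = 0
          rw [e, coeff_mul_T_of_mem_adjoin hb (fun i => by omega)]
  have hsurj : Function.Surjective ψ := by
    rintro ⟨u, v⟩
    refine ⟨AdjoinRoot.of _ 0 + AdjoinRoot.of _ (u • T (-1) + v • T (-2)) * yFun f, ?_⟩
    have e := (overlapCoord_add_mul f 0 (u • T (-1) + v • T (-2))).2
    refine Prod.ext ?_ ?_
    · change (overlapCoord f 1 _).coeff (-1) = u
      rw [e]; simp
    · change (overlapCoord f 1 _).coeff (-2) = v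
      rw [e]; simp
  rw [h1, ← hker, (ψ.quotKerEquivOfSurjective hsurj).finrank_eq, Module.finrank_prod,
    Module.finrank_self]

end Overlap

/-! ### Smoothness of the sextics -/

section Smooth

variable {d c : k}

theorem sextic_eq_sum (d c : k) : C d * (X ^ 2 + 8) * (X ^ 4 + 16 * X ^ 2 + C c) =
    C d * X ^ 6 + C (24 * d) * X ^ 4 + C (d * (c + 128)) * X ^ 2 + C (8 * d * c) := by
  simp only [map_mul, map_add, map_ofNat]
  ring

theorem natDegree_sextic_le (d c : k) :
    (C d * (X ^ 2 + 8) * (X ^ 4 + 16 * X ^ 2 + C c)).natDegree ≤ 6 := by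
  rw [sextic_eq_sum]
  compute_degree

theorem coeff_six_sextic (d c : k) :
    (C d * (X ^ 2 + 8) * (X ^ 4 + 16 * X ^ 2 + C c)).coeff 6 = d := by
  rw [sextic_eq_sum]
  simp only [coeff_add, coeff_C_mul, coeff_X_pow, coeff_C]
  norm_num

theorem equation_sextic (d c : k) :
    equation (C d * (X ^ 2 + 8) * (X ^ 4 + 16 * X ^ 2 + C c)) =
      MvPolynomial.X 1 ^ 2 - (MvPolynomial.C d * MvPolynomial.X 0 ^ 6 +
        MvPolynomial.C (24 * d) * (MvPolynomial.X 0 ^ 4 * MvPolynomial.X 2 ^ 2) +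
        MvPolynomial.C (d * (c + 128)) * (MvPolynomial.X 0 ^ 2 * MvPolynomial.X 2 ^ 4) +
        MvPolynomial.C (8 * d * c) * MvPolynomial.X 2 ^ 6) := by
  rw [equation, sextic_eq_sum]
  rw [homogenize_add, homogenize_add, homogenize_add, homogenize_C_mul, homogenize_C_mul,
    homogenize_C_mul, homogenize_C, homogenize_X_pow (by norm_num), homogenize_X_pow (by norm_num),
    homogenize_X_pow (by norm_num)]
  simp

/-- With A = X² + 8Z² one has F = dA(A² + (c - 64)Z⁴) and ∂F/∂X = 2dX(3A² + (c - 64)Z⁴). At a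
singular point Y = 0 and both expressions vanish; each case then gives X = Z = 0. Subtracting the
two quadratic factors leaves 2A², so characteristic 3 needs no special treatment. -/
theorem isSmooth_sextic (h2 : (2 : k) ≠ 0) (hd : d ≠ 0) (hc : c ≠ 0) (hc' : c - 64 ≠ 0) :
    IsSmooth (C d * (X ^ 2 + 8) * (X ^ 4 + 16 * X ^ 2 + C c)) := by
  intro P hP0 hP
  rw [equation_sextic] at hP ⊢
  by_contra! hder
  have hX := hder 0
  have hY := hder 1
  simp only [map_sub, map_add, map_mul, map_pow, MvPolynomial.aeval_X, MvPolynomial.aeval_C,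
    map_ofNat] at hP
  simp [MvPolynomial.pderiv_X, Derivation.leibniz, Derivation.leibniz_pow] at hX hY
  simp only [map_ofNat] at hX
  have hφ : ∀ z : k, z ≠ 0 → algebraMap k (AlgebraicClosure k) z ≠ 0 := fun z hz =>
    (_root_.map_ne_zero _).2 hz
  replace h2 := hφ _ h2
  replace hd := hφ _ hd
  replace hc := hφ _ hc
  replace hc' := hφ _ hc'
  rw [map_sub] at hc'
  simp only [map_ofNat] at h2 hc'
  generalize algebraMap k (AlgebraicClosure k) d = d' at *
  generalize algebraMap k (AlgebraicClosure k) c = c' at *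
  have hY0 : P 1 = 0 := hY.resolve_left h2
  have h8 : (8 : AlgebraicClosure k) ≠ 0 := by
    rw [show (8 : AlgebraicClosure k) = 2 ^ 3 by norm_num]; exact pow_ne_zero _ h2
  have hF : (P 0 ^ 2 + 8 * P 2 ^ 2) * ((P 0 ^ 2 + 8 * P 2 ^ 2) ^ 2 + (c' - 64) * P 2 ^ 4) = 0 := by
    refine (mul_eq_zero.1 ?_).resolve_left hd
    linear_combination -hP + P 1 * hY0
  have hFX : P 0 * (3 * (P 0 ^ 2 + 8 * P 2 ^ 2) ^ 2 + (c' - 64) * P 2 ^ 4) = 0 := by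
    refine (mul_eq_zero.1 ?_).resolve_left (mul_ne_zero h2 hd)
    linear_combination -hX
  have hzero : P 0 = 0 → P 2 = 0 → False := by
    intro h0 h2
    apply hP0
    ext i
    fin_cases i <;> assumption
  rcases mul_eq_zero.1 hF with hA | hA
  · rw [hA] at hFX
    have h1 : P 0 = 0 ∨ P 2 = 0 := by simpa [hc'] using hFX
    rcases h1 with h1 | h1
    · exact hzero h1 (by simpa [h1, h8] using hA)
    · exact hzero (by simpa [h1] using hA) h1
  · have h1 : P 0 = 0 ∨ P 0 ^ 2 + 8 * P 2 ^ 2 = 0 := by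
      rw [show 3 * (P 0 ^ 2 + 8 * P 2 ^ 2) ^ 2 + (c' - 64) * P 2 ^ 4 =
        2 * (P 0 ^ 2 + 8 * P 2 ^ 2) ^ 2 by linear_combination hA] at hFX
      simpa [h2] using hFX
    rcases h1 with h1 | h1
    · refine hzero h1 ?_
      have : c' * P 2 ^ 4 = 0 := by rw [h1] at hA; linear_combination hA
      simpa [hc] using this
    · rw [h1] at hA
      have h3 : P 2 = 0 := by simpa [hc'] using hA
      exact hzero (by simpa [h3] using h1) h3

/-- The sextics of the form `d (x² + 8) (x⁴ + 16 x² + c)` define curves of genus `2`. -/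
theorem isGenusTwo_sextic (h2 : (2 : k) ≠ 0) (hd : d ≠ 0) (hc : c ≠ 0) (hc' : c - 64 ≠ 0) :
    IsGenusTwo (C d * (X ^ 2 + 8) * (X ^ 4 + 16 * X ^ 2 + C c)) :=
  ⟨natDegree_sextic_le d c, isSmooth_sextic h2 hd hc hc', h0_eq_one (natDegree_sextic_le d c),
    h1_eq_two (natDegree_sextic_le d c)⟩

end Smooth

end SexticCurve

/-! ### Evaluation of ν and of the norm of 1 - ν -/

/-- From ω² = -8 - ω, squaring sends (x, y) to (x² - 8y², 2xy - y²). With the odd case below this is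
binary exponentiation, one integer identity per binary digit. -/
theorem pow_two_mul_eq_mk {z : OrderNeg31} {n m : ℕ} {x y x' y' : ℤ} (hm : m = 2 * n)
    (h : z ^ n = ⟨x, y⟩)
    (hx : x * x - 8 * y * y = x') (hy : 2 * x * y - y * y = y') : z ^ m = ⟨x', y'⟩ := by
  rw [hm, mul_comm, pow_mul, h, pow_two, ← hx, ← hy]
  ext <;> simp <;> ring

theorem pow_two_mul_add_one_eq_mk {z : OrderNeg31} {n m : ℕ} {x y x' y' r s : ℤ}
    (hm : m = 2 * n + 1) (hz : z ^ 1 = ⟨r, s⟩)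
    (h : z ^ n = ⟨x, y⟩)
    (hx : (x * x - 8 * y * y) * r - 8 * (2 * x * y - y * y) * s = x')
    (hy : (x * x - 8 * y * y) * s + (2 * x * y - y * y) * r - (2 * x * y - y * y) * s = y') :
    z ^ m = ⟨x', y'⟩ := by
  rw [hm, pow_add, hz, pow_two_mul_eq_mk rfl h rfl rfl, ← hx, ← hy]
  ext <;> simp <;> ring

theorem four_mul_omega31_add_one_pow :
    (4 * omega31 + 1) ^ 456 =
      ⟨-0x125d00ce9b482334b017e6090162b3453b16a437ce8f9200e5dc644cb39ae938d97da7f8f37a4d5a5d5b0484f48f8a6541c25596524ff57a93da8f25d11178b2fd2d349b8b412d3197a10fb5cc526905dd7f99f2e202de5788157c3d8eae0a80e324d1cf281fa16b7c4f9a02b420dded1467e94d1f8477acbd366fabdd2621cbba187cbb19d589b372b20fe35daac578c0fabe0683e67abea413691aa9e6f6f8a3370530623dcecd14fdc916bdf93ca0904f1a2cd0ed33766105ad0a73b51660953757691bddff,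
        0x6aa753879a2ad39167e454a520dafee93f46a73191a2b89d1dca06f0683009ca0181a1cf27d30fb0b9f58686b4961cdad8b7057121d8138615a55a83648aaed1ead40a2b328553e58e0f1ee91474e9c1f544ad6f8ef6b84f9332b0ea3c1ec7268dc820ca066200be39563734298a94e433af482c48f62e6bb65f12e252bc197e113161007c369d56da29e87bc260e48b45c023837c5a8d76399e8e6eff280c4ebbf25ede57bc5b01c736cd4a35ffdaa9f93cb61ec36ae2a034147617af728948fb50bb4b60⟩ := by
  have h1 : (4 * omega31 + 1) ^ 1 = ⟨1, 4⟩ := by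
    rw [pow_one]; rfl
  have h3 : (4 * omega31 + 1) ^ 3 =
      ⟨0x81,
        -0x1e4⟩ :=
    pow_two_mul_add_one_eq_mk (by norm_num) h1 h1 (by decide +kernel) (by decide +kernel)
  have h7 : (4 * omega31 + 1) ^ 7 =
      ⟨0x930381,
        -0x60ed74⟩ :=
    pow_two_mul_add_one_eq_mk (by norm_num) h1 h3 (by decide +kernel) (by decide +kernel)
  have h14 : (4 * omega31 + 1) ^ 14 =
      ⟨-0xd12a93cd9d7f,
        -0x94064db80378⟩ :=
    pow_two_mul_eq_mk (by norm_num) h7 (by decide +kernel) (by decide +kernel)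
  have h28 : (4 * omega31 + 1) ^ 28 =
      ⟨-0x201d3c3b971e22c27ec153cff,
        0x9c4c3de07b4c59ab027898d0⟩ :=
    pow_two_mul_eq_mk (by norm_num) h14 (by decide +kernel) (by decide +kernel)
  have h57 : (4 * omega31 + 1) ^ 57 =
      ⟨0x5b670f2dbb670f046522e2bcad1089498c935c19b0cdd42a01,
        0xca834c6f3775a142f7356bcf2afb5104abbaaf6c9c731be24⟩ :=
    pow_two_mul_add_one_eq_mk (by norm_num) h1 h28 (by decide +kernel) (by decide +kernel)
  have h114 : (4 * omega31 + 1) ^ 114 =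
      ⟨0x1ba0d288044d20cbb6fa3ebfb6550a463bd1a65614a1c8ec1ae76ca50b76816c6f2fd9f9b00f286d99e96d625008ba80ab81,
        0x86992e82e3465e1900333998a821c2f270d4f8eb4d71b2cad186e45aaeef31e50042ba776934d34c1e1f4980d8a2565d738⟩ :=
    pow_two_mul_eq_mk (by norm_num) h57 (by decide +kernel) (by decide +kernel)
  have h228 : (4 * omega31 + 1) ^ 228 =
      ⟨0xc52badbada6f9d56a7e0a94bc7e9b1b32bf18e50a831b019208ec0271b001566a30cfbf79fb83e64046899ecee44fd8471c2a6d5caef1f0b489fcb6c1da5e1d7c078e5576d30b9cb5515cdd671358abf125094676f1903c2f34465b6ec0925aeecb501,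
        0x18a121267cb5b1c2ee6e037749c4ef0c59b87f095f51d0ae51eaf572636662068b286307d42d70492bd16561f35764699fc7685dc7e1a4f49c81f9347ae596f2fef8b835561773e82e595dbb3084254e2251f9487165d3d95236f6b5df3b82a9f089a30⟩ :=
    pow_two_mul_eq_mk (by norm_num) h114 (by decide +kernel) (by decide +kernel)
  exact pow_two_mul_eq_mk (by norm_num) h228 (by decide +kernel) (by decide +kernel)

theorem omega31_add_one_pow :
    (omega31 + 1) ^ 670 =
      ⟨-0x20356d28f52eeecddaa65cca1ac8a0f4c4ed4f3a00c42d88d7cad7fa383c57096b7ece5c4645323089e59e6ce0b53579c89bff25aeb2d6c76af4d19b500da263a621bbb346d542ef77be9af6c64e7d3112eec0e8ab85cd73005ea90b412c231601922a78c6c4cd2579d06ce303ca0ed73e5475cdf0048f5c366612c88067,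
        -0x38e0e0097df260f0f68c41cef8114fbfaa0f2f938074dd78fc9424fc0ef0cd3bc104021287521bac73deeaf37653f89906d2c3376c90af0c8df56519025110646a6a8eefa3356c1dd2cbdd73111a5a81b08d249ba66d91fdf8f4075b96494dafcefc791720cc46d8760f616654592e39204681c43762b4e211a2ceddd1f⟩ := by
  have h1 : (omega31 + 1) ^ 1 = ⟨1, 1⟩ := by
    rw [pow_one]; rfl
  have h2 : (omega31 + 1) ^ 2 =
      ⟨-0x7,
        0x1⟩ :=
    pow_two_mul_eq_mk (by norm_num) h1 (by decide +kernel) (by decide +kernel)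
  have h5 : (omega31 + 1) ^ 5 =
      ⟨0xa1,
        0x29⟩ :=
    pow_two_mul_add_one_eq_mk (by norm_num) h1 h2 (by decide +kernel) (by decide +kernel)
  have h10 : (omega31 + 1) ^ 10 =
      ⟨0x30b9,
        0x2d01⟩ :=
    pow_two_mul_eq_mk (by norm_num) h5 (by decide +kernel) (by decide +kernel)
  have h20 : (omega31 + 1) ^ 20 =
      ⟨-0x3604ea57,
        0x9381171⟩ :=
    pow_two_mul_eq_mk (by norm_num) h10 (by decide +kernel) (by decide +kernel)
  have h41 : (omega31 + 1) ^ 41 =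
      ⟨0x2a8622dcb96ea001,
        0x8be26e838398a89⟩ :=
    pow_two_mul_add_one_eq_mk (by norm_num) h1 h20 (by decide +kernel) (by decide +kernel)
  have h83 : (omega31 + 1) ^ 83 =
      ⟨-0x102c27fb2a5ba6c55c84212413f5688f,
        0x4accc569fa340968af869eff70d5579⟩ :=
    pow_two_mul_add_one_eq_mk (by norm_num) h1 h41 (by decide +kernel) (by decide +kernel)
  have h167 : (omega31 + 1) ^ 167 =
      ⟨0x5bf3fd44cf3d7246cb5becdd75d5dd81ba694fcc6bc51b7a02be771b5f8e951,
        0x56b46dc5f238b36c837da0bf0dc5324223b502a03a3f89c013f2843fcde659⟩ :=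
    pow_two_mul_add_one_eq_mk (by norm_num) h1 h83 (by decide +kernel) (by decide +kernel)
  have h335 : (omega31 + 1) ^ 335 =
      ⟨0x1e2988887eea0fdae032ce01c77d421a69624714951aa2e2afab10a88599b84a975106560dfa4d69f54db01f3311928b4944df2af3ce0ae167af8cb465911,
        0x201c70d25a26caf699b1031b8f86243e07d497205b410dfbd7591feaf11758e12479a234b83f4e92c91685c537aec42c7c794b241bbfa455c7ad5f2d243419⟩ :=
    pow_two_mul_add_one_eq_mk (by norm_num) h1 h167 (by decide +kernel) (by decide +kernel)
  exact pow_two_mul_eq_mk (by norm_num) h335 (by decide +kernel) (by decide +kernel)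

/-- The norm of `1 - ν`. -/
def largePrime : ℕ :=
  0x83b68d96024b0c3b1a4f8aeb51d6b0705d7025798281fd7feebc0d1a5e70943bf60d1a9cf6aaf79a8fb48a49f232d503137b6f1cb30e455af3566894dd487657e5bbce88af13d5651f919709b5aa8a95da47e2f6a5b5ce2bd9cb27bcc45b96ed591a4249c90952cdfed792f65c2bf8002e5c5efbdb06a2056ef765b459a1b66e9fe743e965761f5a4f27c7269fca6e92c242f71f63afa0c3f9bf270328a05c7089e6e6f4fc932362243d20bc2f35f3d2aeff5a44012fa4bab15e994ca028606e6d1aa37e03b113f28ca79ead6e9263c098407c9a2e19747b7fb4bc632c5d808917ec82af63fa53e5529e2a8fbf88c5a1aa37bb807e9df7f6f3920a5bcc642bf4f1b8009979719c978ed059903c5903c1a22977c116db3d79b835b52e035d42eabf205398f5abe10a58c5fed4e22834053d50ddf1c4fa05e69813477117eee35af4e4025d0a3a385a7c87b44ce9ec7a390ddca588a251c78ac9cf1e2d4350eaec54130f288d41bbf85aea34ea0859f147ccc5e16e9593a7150ac1a0009f7cbd4662c825ba484fc95af3e2ed2c5e662011dc004729925643846136363b3318e9ee319efdfe5b901a5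50fd07ff643e130526f4bc3ab60ad7faaf9a3d074fcbfbf2ac4b06d92cf76fa35b7d502279b4bca6e14a9ebf74ebfb6fd463e23e299007a360f6ec27d79ee62b8bf5d4716ff24aac0ed85cb209a610264ad86247d62b845c21149dd1111b3411cacee7b706d9244aae53a8f8ee5af3a1c605a951f08643187a43da835a0441ea5b4aa1794a1cd74ecdeac273eb73a15fa287c2dac6e978b29dce4423db366a1275c2c1a023c82017306a3457f5e66b50cb0c94470152fb4fed26242e7a5ddf6a65e2aac15faa83da68f1e24a7a451f6ab028574a9be28fc2b7ada62742d56bcb6e150a26b0746a325695f7d409f25ada04cc6714cf6bb4daf93bd2f4fdc8ee5e0c4823c11445d5f3bc2742464a30e2a04e10e89a4a4c3aecf20723c02f5564afd2fd31903db9476b927f65962ee63e0c17383dbc476a3564bc7ab53c35e296f7b4e208b07e8a3fde2147d64c0a93e14a98d189b35dda1d66d4434badd2f2b220173598c072ba140552eaff65100a9234bbce5b20a25c39e0797071fbec01c157979520b90a7af5932bdcf54db4251e382f4ede70280eed1c73e32f6e3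

theorem nu31_eq_mk :
    nu31 = ⟨-0x6e03f327c703a818c7a31a16f9adf1e6db67fb29dc594b2990e6c115c260087f42309f3abd272601d8736a2fe45eab85d1c332bfee81f1b8b745c4a29b4c4e49b497a14d33a3f8c0191897f176c32d35b7e9dcc712e11380c6c41c673737e183da7dbc1956d56449ac3d76855d971b124fd7e95ba070851537833bcdc4f5c1c9079ff39082a1d89e6830c60c8829d9a6605174c3af78b8da9bec6fffde859a53a2e3ad6faf73f8aba8d4c00b212d1bfaee1367c1b1262cfc2d81e1debf6b14c55e8b6fbd9c4c7937add813e09d8f648411f691e7931286bec2726226777855a6e0413b1e63330a2b7ca0e74d027f24b49bc79dae44b9573a1ab40d2b1f55c66657821ffd8d026395c8bf7d855dcae4f3ded0de9dda2d9af80e14d5ae1d0dd960c81e4849ea3582f04290b5807e16ac93fc1e2ac0f07769262e71d67cdaac95c7bc6de378956b44d34ce4ed57b1ee9b550961b3075758f141f78aa1140c7a380a8f1836781b98f200cdec72cfb570e45d10d5ecea7ec8f56fc350f1a47f49d4c32fb23ffeb5312b2f54d9e407b78275ff224cefdcd7de1062caa4827cf751e169df72,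
      0x2d8e7d45025f469b64f4dc405243492fb4c773cf19387534bb3a9a3fa55fefea1312c26d9a9281acd5f11cb36af9db9e60192c2143cd028ed7473e7be9cdd9c5610991170c790b7536cd67bf67f0268aa9c8c3df2c5a53e19055e81bf0174fc76e7b60c1a78e3f38579b1be9e8191fe29bfb2f258987cba8cec9587ca60a52a7f98972513c512901af66aef227bc083efe78fe4f93101037f0102c87ba397ccdb51367bf27d4cad4c858bc6bbf18cead69588ee352c056d0e96c51723628a8d785d0c662be0d6bbb5065d2e70287c61600ba8082d085f507efc4f9dc0d3acf8ca1f1b719f650ccf9a92938ac9e271ff645b163c9242d9e523be4dc650f0406f0804b9c93cbdbfd56aa924952a3a5f88c66c2e5d275a9ab1e6d7af96774b36db0abc664c2769229f293e270937a8bcece612698e1ffd2a1377ee0c9a9a0f29c1bdae7973844a4c479f13e0df49a04ddd351fd432f65f7aa94ac209b79bd78d41f9cacc23aeacf8f57f02e4601d57365f5d4a526d425b9d2062b68427a9f73ed80c05a401eab1722f361dcdf9fea2dd1d11041629833c6d42851b97bf4e3237b5f37fe⟩ := by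
  have h5 : (5 : OrderNeg31) ^ 322 = ⟨5 ^ 322, 0⟩ := by
    rw [show (5 : OrderNeg31) = QuadraticAlgebra.C 5 from rfl, ← QuadraticAlgebra.C_pow]
    rfl
  have h2 : 2 * (omega31 - 1) = ⟨-2, 2⟩ := by
    rfl
  rw [nu31, four_mul_omega31_add_one_pow, omega31_add_one_pow, h5, h2]
  simp only [QuadraticAlgebra.mk_mul_mk, QuadraticAlgebra.mk.injEq]
  decide +kernel

theorem norm_one_sub_nu31 : QuadraticAlgebra.norm (1 - nu31) = (largePrime : ℤ) := by
  rw [nu31_eq_mk, QuadraticAlgebra.norm_def]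
  simp only [QuadraticAlgebra.re_sub, QuadraticAlgebra.im_sub, QuadraticAlgebra.re_one,
    QuadraticAlgebra.im_one]
  decide +kernel

/-! ### Soundness of the elliptic curve certificates -/

noncomputable section Certificates

/-- Check that `(x, y)` is a point with `x ≠ 0` of `y² = x³ + a x² + b x` modulo `p`. -/
def pointCheck (p a b x y : ℕ) : Bool :=
  isCoprime x p && Nat.beq (y * y % p) (x * (x * x + a * x + b) % p)

/-- Check that `(x₁, y₁)` and `(x₂, y₂)` are points of `y² = x³ + A x² + B x` modulo `p`, where
`A` and `B` are `coeffA p u` and `coeffB p u`, and that they satisfy `independenceCheck`. -/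
def groupCheck (p u x₁ y₁ x₂ y₂ n₁ d₁ n₂ d₂ : ℕ) : Bool :=
  strictApply p fun p => strictApply (coeffA p u) fun a => strictApply (coeffB p u) fun b =>
  strictApply n₁ fun n₁ => strictApply n₂ fun n₂ =>
  isCoprime b p && (pointCheck p a b x₁ y₁ && (pointCheck p a b x₂ y₂ &&
    independenceCheck p a b x₁ x₂ n₁ d₁ n₂ d₂))

/-- Check that `(x, y)` is a point of `y² = x³ - A x² + B x` modulo `p`, where `A` and `B` are
`coeffA p u` and `coeffB p u`, and that `n (x, y)` is not zero. -/
def twistCheck (p u x y n d : ℕ) : Bool :=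
  strictApply p fun p => strictApply (p - coeffA p u) fun a => strictApply (coeffB p u) fun b =>
  strictApply n fun n =>
  pointCheck p a b x y && nonzeroCheck p a b x n d

variable {F : Type*} [Field F] {p : ℕ}

theorem cast_coeffA (hp0 : 0 < p) (hp : (p : F) = 0) (u : ℕ) :
    (coeffA p u : F) = (u - 1) * (128 - 2 * u ^ 24) := by
  rw [coeffA, cast_mod_of_cast_eq_zero hp]
  push_cast [cast_sub_mod_of_cast_eq_zero hp0 hp, Nat.cast_sub (show 1 ≤ p from hp0), hp]
  ring

theorem cast_coeffB (hp0 : 64 ≤ p) (hp : (p : F) = 0) (u : ℕ) :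
    (coeffB p u : F) = (u - 1) ^ 2 * (u ^ 24 * (u ^ 24 - 64)) := by
  rw [coeffB, cast_mod_of_cast_eq_zero hp]
  push_cast [cast_mod_of_cast_eq_zero hp, Nat.cast_sub hp0,
    Nat.cast_sub (show 1 ≤ p by omega), hp]
  ring

variable {a b : ℕ}

theorem exists_point_of_pointCheck (hp : (p : F) = 0) (h2 : (2 : F) ≠ 0) (hb : (b : F) ≠ 0)
    (hab : (a : F) ^ 2 - 4 * b ≠ 0) {x y : ℕ} (h : pointCheck p a b x y = true) :
    (x : F) ≠ 0 ∧ ∃ P : (twoTorsionCurve (a : F) b).Point, RepX P (x : F) 1 := by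
  rw [pointCheck, Bool.and_eq_true] at h
  have e := congrArg (Nat.cast (R := F)) (Nat.eq_of_beq_eq_true h.2)
  rw [cast_mod_of_cast_eq_zero hp, cast_mod_of_cast_eq_zero hp] at e
  push_cast at e
  exact ⟨cast_ne_zero_of_isCoprime hp h.1,
    .some x y ((twoTorsionCurve_nonsingular h2 hb hab).2 (by linear_combination e)),
    RepX.some_iff.2 (by simp)⟩

variable [DecidableEq F]

/-- Coprimality of b = d²c(c - 64) to p makes d, c and c - 64 nonzero in F. As a² - 4b = -2⁸d²(c -
64), this one test also secures the discriminant. -/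
theorem card_dvd_of_groupCheck [Fintype F] (hp0 : 64 ≤ p) (hp : (p : F) = 0) (h2 : (2 : F) ≠ 0)
    {u x₁ y₁ x₂ y₂ e k d₁ f d₂ : ℕ} (hn₁ : 2 ^ e * 5 ^ k < 2 ^ 2 ^ d₁) (hn₂ : 5 ^ f < 2 ^ 2 ^ d₂)
    (h : groupCheck p u x₁ y₁ x₂ y₂ (2 ^ e * 5 ^ k) d₁ (5 ^ f) d₂ = true) :
    ((u : F) - 1 ≠ 0 ∧ (u : F) ^ 24 ≠ 0 ∧ (u : F) ^ 24 - 64 ≠ 0) ∧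
    10 * (2 ^ e * 5 ^ k) * (5 * 5 ^ f) ∣ Nat.card (twoTorsionCurve
      (((u : F) - 1) * (128 - 2 * (u : F) ^ 24))
      (((u : F) - 1) ^ 2 * ((u : F) ^ 24 * ((u : F) ^ 24 - 64)))).Point := by
  simp only [groupCheck, strictApply_eq, Bool.and_eq_true] at h
  obtain ⟨hb, hP, hQ, h⟩ := h
  replace hb := cast_ne_zero_of_isCoprime hp hb
  have hA := cast_coeffA (by omega : 0 < p) hp u
  have hB := cast_coeffB hp0 hp u
  have hb' := hb
  rw [hB, mul_ne_zero_iff, mul_ne_zero_iff, pow_ne_zero_iff two_ne_zero] at hb'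
  have hab : (coeffA p u : F) ^ 2 - 4 * coeffB p u ≠ 0 := by
    rw [hA, hB, show (((u : F) - 1) * (128 - 2 * (u : F) ^ 24)) ^ 2 -
      4 * (((u : F) - 1) ^ 2 * ((u : F) ^ 24 * ((u : F) ^ 24 - 64))) =
      -(2 ^ 8 * ((u : F) - 1) ^ 2 * ((u : F) ^ 24 - 64)) by ring]
    exact neg_ne_zero.2 (mul_ne_zero (mul_ne_zero (pow_ne_zero _ h2) (pow_ne_zero _ hb'.1)) hb'.2.2)
  refine ⟨hb', ?_⟩
  rw [← hA, ← hB]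
  obtain ⟨hx₁, P, hP⟩ := exists_point_of_pointCheck hp h2 hb hab hP
  obtain ⟨hx₂, Q, hQ⟩ := exists_point_of_pointCheck hp h2 hb hab hQ
  obtain ⟨i1, i2, i3, i4, i5, i6, i7, i8, i9⟩ := independenceCheck_sound (by omega) hp h2 hb hab
    hP hx₁ hn₁ hQ hx₂ hn₂ h
  exact card_dvd_of_independent i1 i2 i3 i4 i5 rfl i6 i7 i8 i9

theorem exists_smul_ne_zero_of_twistCheck (hp0 : 64 ≤ p) (hp : (p : F) = 0) (h2 : (2 : F) ≠ 0)
    {A B : F} {u x y n d : ℕ} (hA : (coeffA p u : F) = A) (hB : (coeffB p u : F) = B)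
    (hb : B ≠ 0) (hab : A ^ 2 - 4 * B ≠ 0) (hn : n < 2 ^ 2 ^ d)
    (h : twistCheck p u x y n d = true) :
    ∃ P : (twoTorsionCurve (-A) B).Point, n • P ≠ 0 := by
  simp only [twistCheck, strictApply_eq, Bool.and_eq_true] at h
  have hA' : ((p - coeffA p u : ℕ) : F) = -A := by
    rw [← hA, Nat.cast_sub (show coeffA p u ≤ p from (Nat.mod_lt _ (by omega)).le), hp, zero_sub]
  subst hB
  rw [← hA']
  have hab' : ((p - coeffA p u : ℕ) : F) ^ 2 - 4 * (coeffB p u : F) ≠ 0 := by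
    rw [hA', neg_sq]; exact hab
  obtain ⟨hx, P, hP⟩ := exists_point_of_pointCheck hp h2 hb hab' h.1
  exact ⟨P, smul_ne_zero_of_nonzeroCheck (by omega) hp h2 hb hab' hP hx hn h.2⟩

end Certificates

/-! ### The certificates for the three roots -/

section Certified

/-- The number `u` has certificates for the order of the Jacobian quotient attached to it modulo
`largePrime`. -/
def IsCertified (u : ℕ) : Prop :=
  -- The multipliers are the intended orders 2²⁰¹³·5¹⁶⁹¹ and 5³²² divided by 10 and by 5. The
  -- numbers 13, 10 and, for the twist, 12 allow 2¹³, 2¹⁰ and 2¹² binary digits.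
  (∃ x₁ y₁ x₂ y₂, groupCheck largePrime u x₁ y₁ x₂ y₂ (2 ^ 2012 * 5 ^ 1690) 13 (5 ^ 321) 10 = true) ∧
    ∃ x y, twistCheck largePrime u x y (2 * largePrime + 2 - 2 * 10 ^ 2013) 12 = true

/-- A root of `u³ + u + 1` modulo `largePrime`. -/
def root₀ : ℕ :=
  0x3674bb39944e0d1276e2178ab53d30b3b270503965e20a0b7543589a4108f62c61ec73543fe8382899edd19c765f2782667484f7bb812c3a8d411157f6bbffe0f950fbe3f4f39b25d1179c4ff03a0182ce871f81655edec583ce61c41cbbb53d514c1c31a9198791a08944d7ff86583123163b03e42652ae7469e157e151ebb8a9a6a78046fab38c30b98f410b8d031bf1cdb465ba8b8dc0e82e182428cecede4e31576dc998dfae91c6236ffb801700598a17e10b74e14d97e0651844480c2fc296b2257031ce1a3a38b3f4fd86c096423209548fcd36f1d06698a724c5632245d89fd71f68eadbdc1755248832b70eb1b3700350f1c5d2fa4893516c43d0cc7db8b0a77a3ac839eb79370be04ec7b1bea8cfe8f3ade736f18cc974f171d061ea7c0745a8dcf2030a9a6e0cb00e3e929142b38fec8d4448be2be86d7142c9c5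c5bb108d3c6a09893531e853174fa694b97aac0c68951aeb0b970032088a280dbfa57175977495044b8408a17606cc1ef3595e65eb336d839d50f32a59966d30206377b5a560784ceb6f194aefef4e4ca5efcdefc76acdf8795875773f400367641eec2cc3650f5d1288c33181c6180b1b10f11e3a22cf43579dfdff5bb8346cae85459d111f5e546cf8aca6e96692f0b87221517a7a901affceeccdcc855efe7da9858096a4dcf599fb0e510991200d233fc8b448f7f023145b11062f8dfb84db0663b266900304972a72d4b2a0b3cdab40751fba8305dd29aee3e31bf3e924db699afa3f27a4d10731345e28e735787f0db87a56b927f74db2397d4f5d2130881caad9dfb97f7ba9f3ef5ea7dd62be70a172da69d8d6d0c7c8e70cfb7a6362aee26242a18a1a4bbcf3a58363f09e23c361393bd1da22487ab5b4ef8123e68aa2c1c5eefd79d37f58259f21444f8eb4541112b2d3b7e0cf80e2fad8d4743aacb43ff502cbed1782e4157517c3b4b02d45de4564ac3b7577b87fbe3d25250a9cc30c251324aa02481d9ed32a63921ed48a92aa71d5ccbba789b2151807ccf4f112a729dc6305a48f559c71f848cbdce2e41bdca29545cbc1fe82c4f62917b5cbd49ef237d332adb8e7bf58ff590632ef656fc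df1873829466318b34980a7b36a54b74fe8aabe7de99b7afc5e7caa02487fda6c557e336a19fb464952337fbf3863a06415

theorem isCertified_root₀ : IsCertified root₀ :=
  ⟨⟨7,
    0x40fc850ed5595905fbaac9acbd6d7adc8c03913708f2617f75d287796a9c8b15d3a6a659c90e7762a964b368b4f60157dbcbe83928da53d75e544675eeb4bba35de1499daf85109620a7a224776ef57375b6e7bd879ffd3a46519d4df7be7ad7f5029c457db95e8ffeb80b4c5d951c92f63f3e0a72b838b6b7150d94903d7738e513eabdf506d0adbfa616c61bd5e4805e1e86c07f047345591d824772bf09b4cdf895b4eaf8ac920246ec5b0fa84f9467656c40e7e8f86fdb7caa353392a4ebd6134727defb16113fe638d5dc8a7562964674528cfd64e5f9bcd00c3597bd5053f4b336549564e079089f25b73d475b4d485cda2edb1457436b3e5ab8ca010de96061e2e3179724a514a2d18fc3c703b6d943b63b71b1ae53fb5a1fb681a193f06fd2d69ecdf8f586d98396fcfadf6aa03b49adba2f5aaea8809d4e5a762fa8a9d60cec6a628575aca746007e1be6ba6598fffe5ec5d9d8b86cdaf7997bbda3f5a787ecd8aef2448d9725bddc1336e277a6e5b9f50e5cd691f5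6831ccf58ed82c719b6a9082e2b5a60bcf79d4e5c77383159040e553f34460c9a46fa198da708402f84daf875eef5c28945d282b344a05c369f1a080262bb50c26e68685276b13d2d3180a67176e1414c72feb51a6a02638e3d766ce00ae3a03d912f961fdf729a177d3202c2d6e403506715b0d546c25ffdb12dc7662523f604eaba3fb51a6029a1c5ed74a02a80c2a3cc56da2cb8e6decdc7cfdfa016f08f090c6b7f0363c4acfebd5a19dd18b384caf5e53cc76aa03d9d4f2612eede90d2253ff0fc982417521c214c0ca9f1d648c8b815f56fcc300e31b8de101ba69a8befc5d91a1636769953c1a61ee8cffa9928ad38b83a50c54f071b8875f5356db317a1dc319df5225dbfdc22a0f068336a99e616136563e83ae51bf95253ff39f0d96314b9753c2bb1c6db33b51939c6bab210d3b84cd6b226d2beea7f5c4f9bf061dca1a3ad0a6d6a52e2b143b977d9189846a0c354a5134b4f7ce7f68e2bf93760471fc0543af02f7ce0fa6e032481c1915dabcd8ce5be5dd4650ce0f9ca90492ecd9d2ef4437ed50a81782a2085a6192ade303cc0ac3886531a501ca55d2761c42a7693e8ea8bbe95eb5d52f4f22d7ae6b31d6934867e0d6af61ef03df5f7167deb9e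51e79254fbbf41b,
    0x63799bb2ce32c2e055d1faf4e170d204ea330c3048afc0604c6a69eb06ca7bfb5273076b178f778e59c81d98b24b28e64a29a2df9d0dc5562e955addca60aea376409ce6960fc1765e67c5be361e1f362383c63a2fa7454856a932688d686a2d1f39d0460f9e95acddcf8be2b4499187eb287167fa90d76f13d9e3eb222f7e8676e2f1a4260256d334ba3b94a804c2bc045756a5555377c2ea4ea75ccc0701d806d21752d502527c1ec4f51566c0b9f3069d329036f27ff17802063612997fb5194f5c9a8df4692ee90f669fa5985eb25280a99c7da519d8ddde41abb5c02fd70c3c8b7ff6f0ba18bc05058fb6537ff8352c0ee996ec675ea04cf1dd3eba217aa76dd89a6c5ea4a970cbdea69932bb25b46e86d06026ab992a0f3710a89fed369376cee9f58aaecd7f3c85d88d74157f67d49090250b0f71b78cee0e8358d37ad6b7ea910ac1e029eb555010732d5fec58cec5742767e0c8b9f76de61a196e31dc1716ee5012d81d350c1cb797f4911a05836569594caa2212d8ecf87486f6063817ed54e6bad7fe1d304af042cf634abc7098d976b0b2db294ae53f443b9afd2a0cbe4d6574a9ddb130524675fb3df01279a9520604a24ac636c222d453f349ac009947deb2ec8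f05e94f5096e7e19d0c56fdc46fa808406e49483766c9c8129baaa49f81d10e089b707c136631a6254e9c7e6f77817924fea5ae56be13a266fd4a12db700fd5ddc83291ab929495ce970a943aee4a1f9c8e115c83e04d9e90f13c3e84ac2688ed7531784d59e87d6155db998960f20ceb7f738f3339b37d593a5fbee6a84a4e7efa074b922cd63a460bf181bcb99ba4a6d7e8cf2d2ed3ffd121e810cb73aef3c03e5c186a484257139d4adb57948d5bfbcadd414599c83c8ce78d1788edf691b971fffdc83d838762577645711d70e870931b1daa7e7a243c2d0db7d5ab9a7f0d748632ce6421be248117ca5a3086abb3fabca33a33d17265c9ebefe7093079fb66330e5826f9e68a7ac697ded14be9ed18cb28d4c1b7e41d1c7c690edd7f2f852c78b2039c43db6267709a6bf6b37a315f5c370d6e0c9660f3e4b10996e5a5bb2b8e1197bd13a219ea3fd41b1137debedf20c28db66871477c6bd129482d63435323de8366da3f5ef7c9385ca733d31a184223419b3ab13ac97f40e8,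
    0x7cd1ee00fe2375b4bae8704afc4c37fa0aea1e2479ba3789cbb17928e30dc5d7ede180365bf97d7004a138e07163dd6ce34f29fbc7c2d47e7a7f53c993655c3dbb4935ce73b12047b19c3debc94ee0816ddac08be970cbcefdcfaa77f869b41eacf2d877497b106c6163804836e8abdc0c7ba2f5b6f7aed91fc9d7f17a8715a25ad049293c9948bd872a047bcc60e5722008ad7d637249add3f4b4903f238f91f5624793353fc4b5eee5f13546a0057b8445c2f77d0cef4920134c9f338487745f0eed58908a7becae7c4a01474bb35c3eec297867641d7fede295d7ff803e1d8bf7c7a5c52c540c5d6b2c8cf97da594aa9865e58090f85448df08e5710505163f52e546a796d960c5eb189d20f5136cc70ebad18b070cef4d2b622f25184ad999974ec6ab9d398f7d8bbb5057119a2cd1f44182a7f6442dc3c250b42c11be7a7620c10ad6ebfa538a28f7d12f4463f57f80cac4f0c945d79f1fed2c1cd26969670ddd571af6878e9f0365d1e45a437efec984d40fc59c13483ea9bbf13a3be21c625dd2682197e88695da5d993bbbea4a42195f52dd333e5225975756089c46ca607a5fab9543a81eb84c177e2a3439a609fd420d9fb7bdc2262b15ef6fd68ba4d55c9d567f4d0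ca0fa96fa792ee45941e75b435ff6e458152284e195ef1d138b0c0f7941a0119659e03105e5732032d50b9c98b9acfdf7f46698c1390a4142e35e6a09a1865f0398d331a5472a7ad41e864289fe9b102f67b83930d677d4dd0d804411edd8f048324552c4cd7d7954db9bb1d6064c8f445e36c9f0594980ff010621c46131d93f3a216898ba202c2a708251b1dff87f56a127aa40a5fc14a135719094b916b3aa5a76f2d1ea2413649007a24f849fe0724f9a2784cbd97597d683c0a9193544fa2f19b5a994e47a5000dda28dac434edeec07cb8231793d9ced870af1551350020f92f15cbc47fe31a8147da9c930cb8078a93333f83b136c607c3449a553af655ccf7e7b1ad190a43d7121471779164ef4fc5eeecf477ee5ff15648ffb6903ee22b8ca6e1d451d22da1d394df918cec27197393e905a4392a22b4a862506d6c4bbae2875b80d095d2a12aebbc4c24b3708baa4590ab33e67bf7521943166e8b64aeab3ebd04812042cea1c84e0f6cddb4f9d53655e627608b4c9ba39,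
    by decide +kernel⟩, 1,
    0x113e6977cafe762664e467b9dec5138918e5df037bb5bf9f7aff0e6c51c5b533b973912407df372a0e9ba2b01c6820b74a521175257d9262681394c5dcf75714306e025ae3a62406b4285d0c8306555a2fc9d37ea78e96bc8a0da10081d16588b7d9958dc8a1accae5430cd4586e2ccdf752bfbcdf12113662c6daef40d44d4dab7f73014c50635c0afcf6e8c6e6a2b28479ebcb50b651e65f122c33217013b3d6371ae4d04a1f6f651cfc403827cbc7f54e95ce2ff2694203c177a09fe6e849c5fa73a4abbc6768f5b44366612d2bcaa42fd039e9d4571285b455c6b387c5e42f87cced68479c800c48c1a1e8516849921ef2c4d5547ff20d8b5e63c92dc6992bbdc820754214153d31a3ee4b0282a0ee1d41b2636c2fccc049bb4344ff3a699359a4bcb015d1ce29c415650e7611d683f508d4fb4508c5ad99210a3fd0762a4ca723dc9113bcfd5830c700a8953248654b599994599e13f4d7cead21eb9ceb84c0294775b4ff76b3b31ead540e3a3e56cc2c22110837bd865504b1421ae1ea6905ac70c7f72ee6804dd35d06619830ca65399a85f9f4fccfc74f2873bd401d62e915da3c589d9f33ca0ad6bea91c745daa089a05df435cc1fa8712e7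a461460421d861f5bd61772653c8dc7f82130a6f3cedf316d68b2ca6ba2aaceb47b12abd1ede160c980689ea12af1f50a73540cd57d6a9a2b60eecdbe007cfd146d24dd46515a9bce9c3a80d2c30d7a0af0a5805d2fc001ca2b505d222043fd30df62cde87f20b94059fd61813fa221a438c4b9ee1998962a1f0ac8132b6dbea68025ed342a18be22e50823a001cc51b0458ca72d9784798d89c2b6e73350258486b8e730df3c848fcd61be43ac1db3718d3fcc70aec504aa44b5f34c7834c7f608c2036224efb6d63f00acaa8237e666e5a1f0b62013a9d3d940bac77ebc79042fc0d1441722e409f351bab30750efe19f8626b91a969ae37d94e33f7c48164b795034b7f9800ee3b4fed6c47075844b793146921d68ae9d868718846171c5386b4cae9a452e9bc60cb5ce8b7819f433702a2713b96362ddc3ded8d9b8eb3a758091434485a006dd7d4365ee1022ae6ac3961ba05368fc07ab0650b353d5beadedd32932b3c66c400d8e9e13c47b63474a312dd629a5f621b5d13dffd236530ae0405ab0b45ce,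
    by decide +kernel⟩

/-- A root of `u³ + u + 1` modulo `largePrime`. -/
def root₁ : ℕ :=
  0x37164c8720b9fc72bd05228a674097442c0092d72523a13fd4b4720885106b0d6a6d22c5de60f02d2dd175cd0bce50186dcd0d63c5e6cde9567bee545448a542b22b919c2409a3b5ffbd1c9d125fbf581160b4a8b3f130f4d490abdace0b141c5910895f7b44f1966e99c8850cf5f01b8f4dad0f8cbe4cdb61c3b1143d6fc118433649f93d09ed0d6f3e587c8c7d46e6982340772b83841d74ddc992135f5a4e6b51008ab61c15154f169de1fba2aa553a870816224db82d07a78a3eb98ca8fd9c47e20faf569415870be1d8c70425e767207507e7e548ac2f2e839cd5167488583970c8209fc0d31508b1428c820f433e43e9e2295b4046068860ae434e2f29ed85c1abf6a46dea9f4d4cf1a137d40364a105e278c61b752541424567bcf91d0bdd1371c4dfbf6227e0fb2b4551fa082f51789589e153a523fa3ceed4d94e6a072c090d4dda575e783bcaa0e4c4176702ce017007a61bff6c4e4cad6661cc8b1c09ff7efbbe6adf0bb025ea8990376e9c81797be83dce4af51d7005eeccf5591324e53c2747ff85ca35cc1213ff6e09fb8b261faa8c75635c24cae22bc60fbfb0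610dd0136b5d629edbe79e5ef28271342ba17fb3e67a4b0241feb8c30076782f0cd7247475f970d70182f940cc67bc1c1cbff3339f967b3d6df1761d7427b7f09c29fc50f1e794b5ceb820404c65c940526d8ed1b3eb438c4ac68dde70d29eb3c183958aad24293e447769cb08e1858f2ffa36034ea844af3032c9f8640ec7f1da360aa1c07f002f84781a6341a6b24b376025af40a5e20c02b776a847e47e638a67c4651d6d3e56ed69d80651b8d6e33a5feae352f301a53797790ad0ae200fbd742d591b94389e72ef7c6d2aa001e5e44161e52f22fa3268e80017ed460fbcf502f2a601c8c20d3df833e1ff95e77541e2a26023d90a55d5cbe8b11db8982ff5b0cb80e2be39f05a8676e06b0d80ad2190b89aadc068330f153ba748f2723505367a49bd0674c3270e8365edb52ba1c8e2267f66c7acce2c9c179422dc2f04bafd4d53bc894df45bb22207516dc1e2961b7ba12eafebbfe5fedaf77fca489a8a506c3b4b0e65a79c6d3d0dbe92f742ce291b06c833b76c860da6e4add73787aec9031bd2bc183578e9f25de6e70e1e496701ffcdea56503d027bf29b087425c0051d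

theorem isCertified_root₁ : IsCertified root₁ :=
  ⟨⟨3,
    0x3bba92bbbe5f774944f80a220ba48c6d9cecde9c66416b869a514cf72b0057acb6a91a082376b1551ed69eaa5622ca47985fd1df5790f7bf76dceeb11287d629c0671f207ffeaef0a7ccd6432737b3fd56d125b369c24728cfafc6679b03be5b95a624f709dbdf8933959f32cb54637e27472d9e7e7694ade8f1722a894d31985403b478d78fd87ece595a83db8038e588ed3b0f0d2064d7c978553d4f07a53d467c4a7e480950977000fc987896081e6d5196c7368f1640d78f4421dd40784b8e83100923043e39aaee57850e79381586e725f13a0747e87f7ca9b7e22b57988d099fa74d2db8967c46f4366e63d86fa843216746cb5fc49e41920d603cee5180d0cbf7ba54ec4a498e5fa2ae02ee8733b9cfd947a35d11b848a2bf7bed1eee5038347eccdf3b8b643e6c0c22be4adabfeab7e6747f4bbd176706a0d22f8fda82ca583a820ba2a3ee2462c609942d24b4ebf3f35787f4203ec2e2b7f0a3cfda34f059ee90a57d647aa27c50c08d5a1553f828409ba7c5860f3e75008039635a531673df59bff6b5874950602b7434422f73c8bfaed7975734b085ed9f95f8401c37bf838848fe2b83bced5efc125723d72d2996164d44273e0a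b6b4f4bcc85c1bc83cb079432fd58969ccb931725b103918114f06001415ae43300203cc6538227bc2ceff6cb59d1c1452dbd9cadee9533613cc8a9fc0beb0b988cc0be75d2f294c9d2f60f26a6b547e2e5040d6d24e5aa874560c5d27c0ed354974b0bc6caaa2f4a2f9a770c9e128b73dca6d14bd1a968467067882e1cdd9b634c8b28ed7381478e87d7deee7c929111bcbcf89eba01ddb81bcf988ed60c9f5dcdf26fbe9d6687452e10a1626e186db6ccc67da801a37ecbea02933d96694cac9bd36d1f4cdf319ee6c23c20e18e564d7533a1b480fdd6895e18a1958a23e4ada488def9007efa58f2e3272b8e56edfeabc90e40f84989577ab64b546c8821c3886f7bba45cfd776b5c5a5035e13ad68730ebff48fcb91c27160e45186a494b508b6131ee7bc5e33b65839b8189a60a1f914df6513f49e0ce631f91109b8bca39a2f949a5de4ff8c780b6ca5aefe5c92facdb77a0a368a400275a217c28f598c440285bc6ede503e4ebaa3367d0a28ba5e09604153c1a175619a23bbc7846e74dcf3dbcd7f309159c7d,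
    0x39df4106e3cf76c63d73152096658c3892b52a38763cbe71b4ae01d841c0cb5114578672c2f4b1190ab90a4c932adecfd0f77bd51e04e180697338d76063126594b092de4508ddd7617cb6a54eab9bfc9651ac31e43713eb9da67e03b8ea0ad69ad3dbcb9f7272c5ec00428752d29c8fa5977f8b9d0c4c11592d630a71ae1a623fe6e1d99868bf36de9d33e64da06235708452bd3c10eb80b376670ae3b89099bd8cbd58266d2c32c9c1d29b15a91cb09234025307ee8d6119ed722b7b1638b227b5bb7a231a4069ee7aff39cef4039a9cb24f6816be319edac7a689311e85110313beab086671db9f2181d0ff05f7864ca34f95e7beeb6198cf476d5641414c22337a7f49077da2716530373d72d8378259e7cc14f5cc8a4a5a5eacf8dbf83f8f9a0aa1e9e71390e66886d4ffaefd5e4ea519e4813cc7165ea7e4f0c3ee0cf6e90ef507bb6ff0745cf586f3dd761be9d9372737bed77749adb8afe6a4e59a81ebddac01c47baf029f0e9aee0c50ed4993c2363bb71f0cea5e7ecab55f8b5c545fc03f86f19d01ba329a753a34d32f34c1f34795905941be478876968728f55420b5907a51ed7578f6cb411599994f54d0645b7c496ff5dc0aa78b4f25989cc53724ebe95240a04b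f13dc1e65d23fc2c09f47c7311d1ea5522e278c8dbcce988217d808e1e00c6f9d9793274fc79201915b9c9c2bcfbaf47d166bf533f1469da8e0d101e8783cd1986a23df9d33e1bbc2eab157ea293beac1fec6e6b28f9ab59038971bbaea3d48d4e8f8a8e1732d07600133998b44273633fc0d88eb768c85360a99e814b922cfb70d3c61da533c58c8cab691abd91ec302c31041ae31553a69224796002f970e28c5ee6463c5831ae8e228d39748713f21b6538ecc10be80bca519b88b917d0c7591bd819480c6a18e6382da578cccc3d1fe975efbc9237f3d309701a64566dc63621b6df3abda9c586db126c37a48c6c7cf57e9d2501914b5f4dfd6c849ab409d155d91ea18a578c352df9c613d048e0ace39014049dcd207cfde81f1ce6b4d442445c9afc9babac2bf6fec42c628367c5f9d9a795aa3af73211096e0d416a6032af869bbedde359f4b097e03aaa6e909cb97a72892b50c82173d618db7839285e858d7b9037a4b8c2076aef95f54341c3fb6698dda7214576f6c1a4,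
    0x4cd6f3a9112701478332b41dc9e0d133f9e20eb8220b40b7cb26e5bd442ba23db6927581dee25060f0ad181735e606c499dedec84c4467c182bbe1c88c587d6d5af73e08748a112dee28e6e16de7f687f2a7f5448eb0088627f8b741a6f91a4a79f8e258fd1681c0c53de41b6d237de436a6fac7ed36059d783b599a099aa529af305b3536e0e8b25eaa386a60de8144f138e13c38be1171b87f3c3c2ca35d6ab3ce28f1ae44fdb65365ee199a466b0a6a6c788ccabd91a177d3de61193c0173905bdbd89d77de1c1ded9dfa1b9a9972617de0b95904b960be24d53d3abcfd5cf0551074d3a71f79a3740ccb32d6e9558060af6f85e60edcc1545da297964617a2924b3ca90ee012752d5b9c7cc209129a8a912510019365e3b28ed0c2cf3d72b8839ad708bb6d13d08ab2e755d35ff1c1a0f15a3e9e0f96f9297c350112db83d25f8ae2a43f460ec03bc3bbac5a7467c863c5ff327d38a47832dd0a09123d0b8a1e61e458f75bf9e01d0dffcd1fdfafa933e7d428d94b620d8887a5ce256f9f6637fdc893da4a857d19729c86855552741b36b75cc20d9ef9076bf07fa52b9d96809838ca1ef3b09d3171ff3bfb7e34aa685caa60ea24814159da377a02bc8f1aed4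faa82fbaa0b0f23de25f94c0c463e95c81bb9a5cbd63eb87d506a933bf192af8737dd0f5cc884a64815feee40746a0f92783cd34415e7a16152a832558ea528db23b6c97e9a7cca83c1b1e2a4ce747f7b0b01f123adef88bb9beaf7c857cc8ff36712886162dd2cc6071c5479f4830df4a0ba32c449a667ea939ba286cc72e67a33e882665d37f5a4c4d9861217e80f4ae166adae6b053688f95b833bb72e9041d998ee76c49a64efb6c50ba5f0198a46efe81e1f0b3bc106232cf76fd1aa86104655aa41c90bad900f26d4cb5be3df28b16b30fce6544818182c7557ec2eb1de61d59b870af8afbdbcd5adfcc220d8bab9251e276d7a0693571d95d3d141da371ceb7b61b11964ccb10c57f0f468bd3422fa1e1402cabb792c055ae2ec091dd897fac0c0927e3e1e1a82ba3b6a5ddab34226fda7718f72e386889c67eca4a53e251157572d3714fd88cbd3a6251f08eee37cc4d367a3c70f9a8ccbdd35a1f3e63cec45d67c2f358dc2f733f29817a35a6ac0ee2a8476d8eaf5904aa9144c6ebfd6,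
    by decide +kernel⟩, 1,
    0x18c68770569a853c5e7f03bbb953eeb0b525ea7d57037a0a0832d95e8f3f848cb6e18bcca6bad9714a2dcc69cb7c1fbd74ed35405ddb8c0ff5e9145ddb46527b76932bd059596b74b82b0d9d6c62b4dadfd7b11a3ab78e93beea68092fd1185a8fc1c8b5202afd4576bb323cb92e574dcaa3b44f2b78a3603b0094bf57bc17a8bb018d6f44ee73e134a396b373c097153393a8dbe784338ff727ce7a95ceb640c4d0fbd6b596627673461d818362180f83692f4807b4d76d7f1df0fbe19efc2b2ed4a7d8f86da9d4765c6d8280b611a27a49173458c811696d9a4be03f2e3341c63bbf3be6bf7f3683a5ab5ee54cee1c75c4a7076021c89ab75e745d4b85a3007785f521ed90fdf66678deeaeb08561cb529d41bef6a1527b9fa08663519306855163fc1bdc1e0684449b3587f4e7df182ddf43dd90caf26d55d6b7ee4385c01e772bf144b5b15bc6c8db8373d4c5ae5947a90fff34685612da9c71b5bc3f272508350d2ea31b7f7c6447cda86137a36e83d9986b59053db4676a0fda66f21742b70558ee44b1438a7da393c103af810f355f1fd52a25e1a511b78915b84c18b549b05dccb6c992a19f6fb63ef29b4f345ba94442fe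e73ca9661c20ce98be4fd2cf6ae5c8173d1fe4ad33cbdc358b9cf4af4aca14f6301f082e579a50ed9d04961297a10aa41c963076583920711c7ab54772262b40324f35bb67b8b5a631b7e5047c9545eecbf7bd1853281e95c6dacde3ea762c7ee722ad97f0cebef71063fd18b64c204fa5a987e2c66a141f5e00c4c72b6d6d7510f4f3ef0bb99a28839a5d2f59837590391e4e0145ac2e4f39a88049def80e1bf1276efeba0d194c699c4a9520bb2d2367e312bfa7149ead570328106046bb00388c03bd8aec34daed6b5d39af05edc935b9bb5bdfc0ee2f92b6c206edf3db3cb24b76da9bd05d80ef219a3683e5955e66bc5f8b6bc0d41fe06b81ea986a3264988ea852743a820313ac3aef0e9d9044a4f44b020677a68ac33c3a3714033e5be30cc0809b6b17c807a4b520526e603e692d6ab038088085ae455c93cf452ffe7f6fe80a3541266432727a9f2794e723094e5d818ec506969d5dce3cc91eef868e0ac15145d8317e3785c3a1c50b359808ae116cf977c5047040ba91db617c65631d606d5f375e3a8ae76bcb5fb30,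
    by decide +kernel⟩

/-- A root of `u³ + u + 1` modulo `largePrime`. -/
def root₂ : ℕ :=
  0x162b85d54d4302b5e66850d63558e8787eff4268f77c5234a4c442779857330229b38482d861cf44c7f542e070055d683f39dcc131a64b370f9968e89243d1343a3f4108961696894ebcde1cb310c9bafa600ecc8c65be71816c1a1dd994cd93aebd9cb8a4aad9a5efb485994fafafb37bf876e86a22027b98c9d3483ae0099db30a526fe1717ec0af2fdf6907c02490385202427da08ee59cb3454cec723343d0648efc7cde2e9e43605f6a3813327d1aee3a4cd36d0b4011d6a9f5a253ab410e3c0f48e428b1c2cb6308dfaa077d42eeedfe3db666f4dd801fa01f3281a8de79da721023f1a836617e2428aad3ff4fba40619b0450f1ddf2c1165c1cd22bfe86798e46089266730409d592bad2680c7edfa1f5aa673acda167a973aa2e796bc8c738e187ef2fa5264a959cecc7fb6a7cbcb1cc4e8b6df8b5ed2214d1d2cb2b27fce8c27ff5d772cf1a0158edd8bc3d5193f80c321690a051e9d14dd464f65378639e33fa0ebc1503b6065e08c2edba3ceb098cc2226b4678533cd057195abd2f3fc8c87ba751883e3e07cf5a7763bb3a85531a205f00288bb8f5e1c812d6c71d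1f040184bfad955e6bd526632895d6200f310d72a4361c9fc3d3bcde071445e71e50d149e1a27073dad2877118cfc1401b0ab2a0a590670901459eaf06f37fa129130092579e2e6f9380a5b54724ea89f394dd7fb526fe0ce04ce954b9779e8281f5c9207619eed77f9131efe8af57aaca203927dd8bfa877b7e71f40c399ad6f9d730bf5bfad47df46b1c15a498c214670e9eb1404820cec73cb876f2857af13d2f9f6e8fb46d5b4ac0cb8e52e5ddb2c772ba113aeb3a43c8c5ea0ee4a37c13c26c77ab38482202c41716298cff80e5d8aa09ed48b1685566d7ba2517cf911b23999289db20757bed0b15e0f77e89a00c87eb6b49f3c6760daa8b71295a6aaf8789818fbf1023f0124082a03da18dcf744e475c24f424f57fb62bd855b1c02860e07586ef42404f0d37561214a2b8fb9accca99305d6d1ba52a94dab3852bb0492c99a767419e042866ed9886b33d4dcb6ca272c998fbceafd764bd0a5658d50b783920ad65e2e3fdc5cac4dc7a6e8671ff4472a8c64ded46f119c06e1365baa106d2f98adb77a85e253fcd1e6fdc1fab8183c4508f12a96a9b345ad40a1ab4d28db1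

theorem isCertified_root₂ : IsCertified root₂ :=
  ⟨⟨2,
    0x8bb13a502e9efe6892861734d2e1f4becd22b1437fe33462c7d4ad67b31e27c1aa27a2faf9833ccfb1818a1893c8d232ac4b4fc6cfc4074304f71fbe2f9679f882a664dc36b33fa115734b35cf848717222b822984c7a440565ce7c261bf6d5f289a4c1ed3575116a675f50f7eea8c392eefd6613a4a272534c5a5a2756084360fe55372afe3d4c80e6851e9a04cf99c0240827176df901d500c0e690e6683b998cb0275fc78e07f0832d1f9604e813aead5262561510c01b37e40e74a10dabbcb8eb4857f4e120cf1aab7326dbb4407b560ce47f6569dce8794b960abab846dee3fe95b0bd7932f9388a662f2b41cb7f8f4ca518c9ee4eedbc0bf27c60c36b32c0ff340d65a9aab0c09aaf492e216e60f64168b16909cb04df9278642695e14cd2c58a2737585cf4b1b17a7b0dcd4850d1486ea81bad128b25de0585f8960a63ec6442e86959b4ca273cd1b12a33f9c00c077114b818f290b84287b68f22293d9d86489a5c732e673f6c335dead34b4315bd19e7c475c80fd28a1cd32a907104f31149993f8713b2a0a102c75cb818f644513878db7c819aac6e49a4a87ed60283059432e1ff3d9d9733b6c81446c2227bfc61c6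63e9a11141c7a85f89a49ae14d011f9a1f9cc7a96452f8549a56b090a9e3304baff2a54baa24ecb7ef8e600d7d035d41e710e68849794f6ac41761003d6554244c12a3b95e1674924c55c5048d22542ac88b21aa165e9bae2e03980ad137431e4a7964e9614e153c1508a17fbf85c36d4ee20075f6782c7aec95c625e6939414bdbd606e9257a4ed54fa50d4aa8681a437cd53c81a007405d7fd298fac01c6366a8d8d16bc000cb7bccce166829235e3d23a6fd82575f57e2bda3a3fd6f57f97d1d47cf5c1d58da3dedf0d17f3c642e38ae9c847f7fd4788efc624a0785397e83a15b90446cf582785bd5815233caed6fd4d15f79f34cac79852be6e9c5d5d2971800c08cb1b2414ad7115a121651a681228396891fb2e3d1705b6e304605c11136e33eb2c3a49abb8c111c5eb5ccdd3360c37c253baa31a3bdfc4530a945b60dacf706ddb3b68e3be9fb64fb5e75b9920a5b0377b356791e24332512cad728a5a25204bfe177067007e9c79dc5556a87792deb610fda88b46090b864428d20acb56380c4103a61cf61b0aaf24cdb0,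
    0x4ed5bf0b607ad015de1daa9e81a2ba1b0354e1db218030e180e69adf9e35d45e47d0e8aa6bdcc656ef440c141774e5aa4139a9dbc19dc806fd54ac9d39a8fc3cb1e106072414b423452012362fc038e086042b6226f0699794200f42026e29b0fa6982e88c69bbee25da6427d62825c9c51125af04c3012d7cadc0fc9492326618493cc1d263f80e6c4856df3e1a6c645c885f9720383da82bc5677216631518de9584c565a3450c8a0960dc50d0b62a52bc826b08caf21cb26660351ebf0b8ad9ebb9fc1e5fb8bea1445bf72e05ba68a25ac935f30d23cbbac355479d0a6efc68c338a2fd0f3bb9661231b56916b41db691bfe6f9141eaab0a35fa8f70a103934d901679c3c4d5d1f10d5dbb9b48545750483773b214260f41bfab0fbe163d4462717a2ba751b4d38d104412102f344aa5ff92ce03fbca2d1a110b5a08c29505f53db95c7a9f16719c9414e22d3c7a3d5d52265515a73af147013c2328272ebc2fc5b2b86db257e300f659ccceb7334f25e077b35a78516e3604432ac88553ce4a02c43ad4a6b2db19e3316722443625104670edef0e82ac65a29766cd41ee5446acb7b5a38c48cc21b3e3704d8edd1d6ecb84c32583e624db7283fb0dd515fd9857735f6286dd49e86349cef5d6d3031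361b84924cbfffe8ede9dc51b40f72daf3e3ab28cba12c42fb9ba5c147568daed9bc7220ee0afc3a51b9065b27e158191357ceb3ed710977b297f53e1230002e7496fcd1c6bd426b4162e9f3dfdf628964b1ad7761bfbc70d5c2e9333813aaf7c4c0c09f7e9bb94f2338b6ab0fdbb97c6ae95fb6a5384951c12fe3905b79f413748ca5e12dc8a0d76d1aa348ddfbba5591e4d2baf47286f16af2e7c8c0c035f45756b605d26a69f21fa3702987fd50ff162888c166a4c4aefc5d8c8e76810fb271f492640fc2f654ceeea60505be0fe9b6235c62446026de45016e9b3a2003543364592fbfc644925ea8b55e86003ac5b4d5c54755f4b3fc8e00f45c03abeda138d2ecd4b05ab4b634879bea6d0a7f43952277d0099d70f1c46c511411e904d64663b29c6115e0b2c37dff3bacd2a92616d4041cf4c776c5120c2a6c3e6ded0a051b2419784ba4b2854016e1af4b21e9f9f80cab435b1903f5041b72804710f4be62c9b1face38d1d4b2eda1501ba62ca86e0c,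
    0x2bb910f6b91bd3ea464860b167baf647f6ff58a43c83b9a9da4a28c5480851a3360b3f403255553977f5d37d28c809b3e63cb41c49e39035879347ce5ce5676390260d6e5f241487c1895e38c3ffafcd69afd3e3d85cc887868c4af83cb0fcd3250b77252604e1bb9851f45cdb4d2e13c1adc2ed4662ca0f9158d992a293bf0a0b9175a4ccdf6007d2d9aed0cc3152729f990dac8f479aeaac64991eba22ff61ead375d61cc73dd08a0a52f7604d5ced598115f7142695410c79b7c7d5bb75970aab9646da96e91f1aef4988a5128fac0545aab7c7c29f6aff58a635aa87aac59076db184b59250ad2cabab7ca0983e366d34024ff8c557d61ededca1228e1bd8b8caad770e79de02d2d12d1f492f2681abf71b87eca1551af11afcb5c61b34503b2f7c8d7b378499d1794b1fddc575c681f07d0db45effdb0a4272abe8d670fcda1047fb0c169bb892587b4bd2e942059e16d31c79577128695853493002e2511cb9b6d8227e865154d679b0c7a0cc169ae3f23c701ab8823f2515a9bbb70f1d084f0ff3e02b60285091089b903b29a2b685cb354fd72455757a7dac1c1b817a7037e9f1d92a675335376dad87b6d0dedc43304c02782118f4f7927f5885b97a8457ee138cab3feca12596b768acd2b75d7a3e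888e51a84b1f788af2d838ad376a712c45bc1d10da7e440c549d561a9b0681df40181609bdda1bc83629a3668ee131eaddac63eb5c952ca7f7cb612f2626cfddd8f8acb4cb556ab4aa495ba7b1d8fe3295bd767e583f0d39cee66aa78df1be5726c648fa32dee270de95d16f665a91b7808d62ee0d338f2110b06492e9c8061c6db84070b30219662946f7267383ba7d10a9a0610c5f774d7cf57fe53d36bd9635ae94b4107d9da1eee58f1e918bbe06a9c53e73c89625a369569b60e74cb06d849a8f1e10e9dabe531ef63e502cc86ef64c04bfcef1f8fcfb3b761498e15afbecc8331e7402752ce21fceaba4f5c0c3922799829d39645fe3da29cbc577f09cfa798f8f1089a1832ceaf0a074570115101fdde9b3cfda0497b02c48978f4021c468df0daf0c5f352e434f9671e0a3f10778c692a3855115de0d240edb2fbc9a60d8e000a253e68536188a70d5a36afea6dded14b24d3cff0ab245319c54a73599fd3a50ced650118e3ec568eac2f15c5,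
    by decide +kernel⟩, 7,
    0x68469d001febfc9024414a7a09a0c526b8039bb175da1f8d0baf72ee7151289b5bd881ea7f13d1d20256c5f1f881966a326957562ec29e0f44c895a45094f9a3dfb512f4628d5ae4842d7244d61897f289e8c55835eaa5ac21b8b8730b1fcac8aeeecd31fe2ec4ca13f46e2d3fa60c26e584a1b89a0a064d346e5a33be805e00bbc325b224a59bcee07d9f966ad31db3bea371eee611c3191cbe9cbb2c131b23bd1afe87c733a57e87f46cdf71079243cedf655c8c9202d4237654c9ba1fbebc1ba5d426214ce0bb5996ea66b9d8671a8d3446791be030a21a9cb1a9dd7ad869476fbafadbb6e272e40d55b6191f40a4bca4a6c407b29766ce012336e2a4d894cbe8833f63578097a5a5ca0117a12982331325254f13e635ebf3fa4fbe8351f6be1ba43fdc0d8004b5c0076557fd8051d0fbe3297e2d9c73852f7ebfcc1a0dc66816603794ee88d31d34a843e8d4e7f3b3f821dfea8efc2e8eeb3f61197fe06dda875c87c8f3dbf5169f9e9d23bd50812214c99a00d5fc592f118bf6a19540fdc10a10618336861d7ac7084b775084cde7b8169c724c081a5304f284516be34942bebd36aa3608e7cf7f4bc6704015e67cca0b013d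a54407f447a6847d7ca1ed99e5d8a7a702fe2e1ae15a1ecd50150927418c4d1ada1fa21950c43505426eb6be9d7ab04e4dd3d00e97ce05c31d54642c9bc42d58dde9bd68ed805eb9bf71af2e6e4b945eae6daf820396a74305f147e5b42adf9f23f460cb174415e4d603f80d792db02e39ea3fac5c18cebc192d1fe75fc6ebd1a71906767735eb8857527e06d2fdb9f194fe25af51ea0b3a40a8eb340184a05eb0464947da25ccf54cbc25416430040bb1751ffd6e435b7d07707c5a520b8ee60812481a99d1050f279d3cf51ebf1633cdb653da6902d67efaba13a1c509027e05467a96469b00db6fa50d1e31668f66a7e0fb78f93f4390ba785b76e0023276e937658f7a9be75217c6fba5e5ff50b6dbeabbdb8ae6eec149f093f1aded9dc400ddfcb143d30cee2dd2020d4f7e402ad32cc754f0ab10c4f8333f26effbe6902cdd63b9a5045996976eb0b54d7a8ae705931f2c91f23dd3cf6e3fe0658cf1ec20396d48a2ab72b124c01b43e49082e1ac3748098d99ead82185908dd1ac2c6c97477b93b40460da4475c87d1bff08,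
    by decide +kernel⟩

end Certified

/-! ### Primality of p and the exact order of E -/

/-- The least prime factor q of a composite p has q² ≤ p, whereas N ≤ 2q + 1 gives (N - 1)² ≤ 4q² ≤
4p. -/
theorem Nat.prime_of_forall_prime_dvd_le {p N : ℕ} (hp : 1 < p) (hN : 4 * p < (N - 1) ^ 2)
    (h : ∀ q, q.Prime → q ∣ p → N ≤ 2 * q + 1) : p.Prime := by
  by_contra hp'
  have h1 := h p.minFac (Nat.minFac_prime hp.ne') (Nat.minFac_dvd p)
  have h2 := Nat.minFac_sq_le_self (by omega) hp'
  have h3 : (N - 1) ^ 2 ≤ (2 * p.minFac) ^ 2 := Nat.pow_le_pow_left (by omega) 2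
  rw [mul_pow] at h3
  omega

theorem Nat.eq_or_eq_two_mul_of_dvd {N c : ℕ} (h : N ∣ c) (hc : 0 < c) (hc' : c < 3 * N) :
    c = N ∨ c = 2 * N := by
  obtain ⟨k, rfl⟩ := h
  have hk : k < 3 := lt_of_mul_lt_mul_left (by rwa [mul_comm 3] at hc') (Nat.zero_le N)
  interval_cases k
  · omega
  · left; ring
  · right; ring

theorem largePrime_size : 64 ≤ largePrime ∧ 4 * largePrime < (10 ^ 2013 - 1) ^ 2 ∧
    10 ^ 2013 ≤ largePrime ∧ 2 * largePrime + 1 < 3 * 10 ^ 2013 ∧ largePrime < 10 ^ 2014 := by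
  decide +kernel

theorem largePrime_mod_four : largePrime % 4 = 3 := by decide +kernel

theorem two_ne_zero_of_largePrime_eq_zero {F : Type*} [Field F] (hp : (largePrime : F) = 0) :
    (2 : F) ≠ 0 := by
  exact_mod_cast cast_ne_zero_of_isCoprime (n := 2) hp (by decide +kernel)

theorem discriminant_ne_zero {F : Type*} [Field F] {d c : F} (h2 : (2 : F) ≠ 0) (hd : d ≠ 0) (hc : c - 64 ≠ 0) :
    (d * (128 - 2 * c)) ^ 2 - 4 * (d ^ 2 * (c * (c - 64))) ≠ 0 := by
  rw [show (d * (128 - 2 * c)) ^ 2 - 4 * (d ^ 2 * (c * (c - 64))) =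
    -(2 ^ 8 * d ^ 2 * (c - 64)) by ring]
  exact neg_ne_zero.2 (mul_ne_zero (mul_ne_zero (pow_ne_zero _ h2) (pow_ne_zero _ hd)) hc)

section Order

variable {F : Type*} [Field F] [Fintype F] [DecidableEq F] {u : ℕ}

theorem IsCertified.dvd_card (h : IsCertified u) (hp : (largePrime : F) = 0) :
    ((u : F) - 1 ≠ 0 ∧ (u : F) ^ 24 ≠ 0 ∧ (u : F) ^ 24 - 64 ≠ 0) ∧
    10 ^ 2013 ∣ Nat.card (twoTorsionCurve
      (((u : F) - 1) * (128 - 2 * (u : F) ^ 24))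
      (((u : F) - 1) ^ 2 * ((u : F) ^ 24 * ((u : F) ^ 24 - 64)))).Point := by
  obtain ⟨⟨x₁, y₁, x₂, y₂, h⟩, -⟩ := h
  rw [show 10 ^ 2013 = 10 * (2 ^ 2012 * 5 ^ 1690) * (5 * 5 ^ 321) by decide +kernel]
  exact card_dvd_of_groupCheck largePrime_size.1 hp (two_ne_zero_of_largePrime_eq_zero hp)
    (by decide +kernel) (by decide +kernel) h

/-- F is any finite field in which `largePrime` vanishes. For the primality proof it is 𝔽_q with q a
prime divisor. -/
theorem IsCertified.le_card_field (h : IsCertified u) (hp : (largePrime : F) = 0) :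
    10 ^ 2013 ≤ 2 * Fintype.card F + 1 := by
  obtain ⟨⟨hd, hc, hc'⟩, hdvd⟩ := h.dvd_card hp
  have h2 := two_ne_zero_of_largePrime_eq_zero hp
  exact (Nat.le_of_dvd Nat.card_pos hdvd).trans (card_twoTorsionCurve_le h2
    (mul_ne_zero (pow_ne_zero _ hd) (mul_ne_zero hc hc')) (discriminant_ne_zero h2 hd hc'))

/-- Divisibility and the trivial bound leave 10²⁰¹³ and its double. The double would give the twist
2p + 2 - 2·10²⁰¹³ points, and Lagrange's theorem contradicts the certified point of the twist. -/
theorem IsCertified.card_eq (h : IsCertified u) (hp : (largePrime : F) = 0)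
    (hF : Fintype.card F = largePrime) (hneg : quadraticChar F (-1) = -1) :
    Nat.card (twoTorsionCurve
      (((u : F) - 1) * (128 - 2 * (u : F) ^ 24))
      (((u : F) - 1) ^ 2 * ((u : F) ^ 24 * ((u : F) ^ 24 - 64)))).Point = 10 ^ 2013 := by
  obtain ⟨⟨hd, hc, hc'⟩, hdvd⟩ := h.dvd_card hp
  have h2 := two_ne_zero_of_largePrime_eq_zero hp
  have hb := mul_ne_zero (pow_ne_zero 2 hd) (mul_ne_zero hc hc')
  have hab := discriminant_ne_zero h2 hd hc'
  have hle := card_twoTorsionCurve_le h2 hb hab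
  obtain ⟨h64, -, -, h3, -⟩ := largePrime_size
  rw [hF] at hle
  refine (Nat.eq_or_eq_two_mul_of_dvd hdvd Nat.card_pos (hle.trans_lt h3)).resolve_right
    fun htwo => ?_
  have htwist := card_twoTorsionCurve_neg h2 hb hab hneg
  obtain ⟨-, x, y, hxy⟩ := h
  obtain ⟨P, hP⟩ := exists_smul_ne_zero_of_twistCheck h64 hp h2
    (cast_coeffA (by omega) hp u) (cast_coeffB h64 hp u) hb hab (by decide +kernel) hxy
  apply hP
  rw [htwo, hF] at htwist
  rw [← htwist, Nat.add_sub_cancel_left]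
  exact card_nsmul_eq_zero'

end Order

/-- An elliptic curve primality proof in the manner of Goldwasser and Kilian; the certificate of a
single root is enough. -/
theorem prime_largePrime : largePrime.Prime := by
  obtain ⟨h64, h, -⟩ := largePrime_size
  refine Nat.prime_of_forall_prime_dvd_le (by omega) h fun q hq hdvd => ?_
  have : Fact q.Prime := ⟨hq⟩
  have := isCertified_root₀.le_card_field (F := ZMod q) ((ZMod.natCast_eq_zero_iff _ _).2 hdvd)
  rwa [ZMod.card] at this

theorem length_digits_largePrime : (Nat.digits 10 largePrime).length = 2014 := by
  obtain ⟨-, -, h1, -, h2⟩ := largePrime_size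
  apply le_antisymm
  · exact (Nat.digits_length_le_iff (by norm_num) _).2 h2
  · exact (Nat.lt_digits_length_iff (by norm_num) _).2 h1

/-! ### The roots of u³ + u + 1 -/

section Roots

variable {F : Type*} [Field F]

theorem root_sum (hp : (largePrime : F) = 0) : (root₀ : F) + root₁ + root₂ = 0 := by
  have h : (root₀ + root₁ + root₂) % largePrime = 0 := by decide +kernel
  have := cast_mod_of_cast_eq_zero hp (root₀ + root₁ + root₂)
  rw [h] at this
  push_cast at this
  exact this.symm

theorem root_sum_mul (hp : (largePrime : F) = 0) :
    (root₀ : F) * root₁ + root₁ * root₂ + root₂ * root₀ = 1 := by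
  have h : (root₀ * root₁ + root₁ * root₂ + root₂ * root₀) % largePrime = 1 := by decide +kernel
  have := cast_mod_of_cast_eq_zero hp (root₀ * root₁ + root₁ * root₂ + root₂ * root₀)
  rw [h] at this
  push_cast at this
  exact this.symm

theorem root_prod (hp : (largePrime : F) = 0) : (root₀ : F) * root₁ * root₂ = -1 := by
  have h : (root₀ * root₁ * root₂ + 1) % largePrime = 0 := by decide +kernel
  have := cast_mod_of_cast_eq_zero hp (root₀ * root₁ * root₂ + 1)
  rw [h] at this
  push_cast at this
  linear_combination -this

/-- The cubic splits by Vieta's relations, which are congruences between the explicit integers. -/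
theorem cubic_eq_zero_iff (hp : (largePrime : F) = 0) (u : F) :
    u ^ 3 + u + 1 = 0 ↔ u = root₀ ∨ u = root₁ ∨ u = root₂ := by
  have : u ^ 3 + u + 1 = (u - root₀) * ((u - root₁) * (u - root₂)) := by
    linear_combination u ^ 2 * root_sum hp - u * root_sum_mul hp + root_prod hp
  rw [this, mul_eq_zero, mul_eq_zero, sub_eq_zero, sub_eq_zero, sub_eq_zero]

theorem root_ne (hp : (largePrime : F) = 0) :
    (root₀ : F) ≠ root₁ ∧ (root₀ : F) ≠ root₂ ∧ (root₁ : F) ≠ root₂ := by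
  have key : ∀ {m n : ℕ}, isCoprime (m + (largePrime - n % largePrime)) largePrime = true →
      (m : F) ≠ n := by
    intro m n h
    have := cast_ne_zero_of_isCoprime hp h
    rw [Nat.cast_add, cast_sub_mod_of_cast_eq_zero
      (by have := largePrime_size.1; omega) hp] at this
    rwa [← sub_ne_zero, sub_eq_add_neg]
  exact ⟨key (by decide +kernel), key (by decide +kernel), key (by decide +kernel)⟩

theorem exists_isCertified_eq (hp : (largePrime : F) = 0) {u : F} (hu : u ^ 3 + u + 1 = 0) :
    ∃ n : ℕ, IsCertified n ∧ (n : F) = u := by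
  rcases (cubic_eq_zero_iff hp u).1 hu with rfl | rfl | rfl
  exacts [⟨_, isCertified_root₀, rfl⟩, ⟨_, isCertified_root₁, rfl⟩, ⟨_, isCertified_root₂, rfl⟩]

theorem ncard_cubic_roots (hp : (largePrime : F) = 0) :
    {u : F | u ^ 3 + u + 1 = 0}.ncard = 3 := by
  obtain ⟨h1, h2, h3⟩ := root_ne hp
  rw [show {u : F | u ^ 3 + u + 1 = 0} = {(root₀ : F), (root₁ : F), (root₂ : F)} from
    Set.ext (cubic_eq_zero_iff hp)]
  exact Set.ncard_eq_three.2 ⟨_, _, _, h1, h2, h3, rfl⟩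

end Roots

/-! ### Comparison of C with E and conclusion -/

/-- There are 1 + χ(d) points of C at infinity. The χ(d) is the correction term in
`sum_quadraticChar_sextic`, and the 1 matches the point at infinity of E. -/
theorem SexticCurve.card_point_sextic {F : Type*} [Field F] [Fintype F] [DecidableEq F]
    (h2 : (2 : F) ≠ 0) (hneg : quadraticChar F (-1) = -1) {d c : F} (hd : d ≠ 0) (hc : c ≠ 0)
    (hc' : c - 64 ≠ 0) :
    Nat.card (Point (C d * (X ^ 2 + 8) * (X ^ 4 + 16 * X ^ 2 + C c))) =
      Nat.card (twoTorsionCurve (d * (128 - 2 * c)) (d ^ 2 * (c * (c - 64)))).Point := by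
  have hF := ringChar_ne_two h2
  rw [card_point (natDegree_sextic_le d c), coeff_six_sextic]
  zify
  rw [card_twoTorsionCurve h2 (mul_ne_zero (pow_ne_zero _ hd) (mul_ne_zero hc hc'))
    (discriminant_ne_zero h2 hd hc'), ← sum_quadraticChar_sextic h2 hneg hd hc, card_sq_eq hF,
    card_sq_eq_apply hF fun x => eval x (C d * (X ^ 2 + 8) * (X ^ 4 + 16 * X ^ 2 + C c))]
  simp only [eval_mul, eval_add, eval_pow, eval_C, eval_X, eval_ofNat]
  ring

theorem quadraticChar_neg_one_of_card_eq {F : Type*} [Field F] [Fintype F] [DecidableEq F]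
    (hF : Fintype.card F % 4 = 3) : quadraticChar F (-1) = -1 := by
  rw [quadraticChar_neg_one_iff_not_isSquare, FiniteField.isSquare_neg_one_iff]
  simpa using hF

theorem theorem7p1 (p : ℕ) (hp : (p : ℤ) = QuadraticAlgebra.norm (1 - nu31)) :
    p.Prime ∧ (Nat.digits 10 p).length = 2014 ∧
    ∀ [Fact p.Prime],
      {u : ZMod p | u ^ 3 + u + 1 = 0}.ncard = 3 ∧
      ∀ u : ZMod p, u ^ 3 + u + 1 = 0 →
        ∀ f : Polynomial (ZMod p),
          f = Polynomial.C (u - 1) * (Polynomial.X ^ 2 + 8) *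
            (Polynomial.X ^ 4 + 16 * Polynomial.X ^ 2 + Polynomial.C (u ^ 24)) →
          SexticCurve.IsGenusTwo f ∧ Nat.card (SexticCurve.Point f) = 10 ^ 2013 := by
  rw [norm_one_sub_nu31, Nat.cast_inj] at hp
  refine ⟨hp ▸ prime_largePrime, hp ▸ length_digits_largePrime, ?_⟩
  intro hprime
  have h0 : (largePrime : ZMod p) = 0 := by rw [← hp, ZMod.natCast_self]
  refine ⟨ncard_cubic_roots h0, ?_⟩
  intro u hu f hf
  obtain ⟨n, hn, rfl⟩ := exists_isCertified_eq h0 hu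
  have h2 := two_ne_zero_of_largePrime_eq_zero h0
  have hF : Fintype.card (ZMod p) = largePrime := by rw [ZMod.card, hp]
  have hneg : quadraticChar (ZMod p) (-1) = -1 :=
    quadraticChar_neg_one_of_card_eq (by rw [hF, largePrime_mod_four])
  obtain ⟨⟨hd, hc, hc'⟩, -⟩ := hn.dvd_card h0
  rw [hf, SexticCurve.card_point_sextic h2 hneg hd hc hc']
  exact ⟨SexticCurve.isGenusTwo_sextic h2 hd hc hc', hn.card_eq h0 hF hneg⟩
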